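/- **Theorem 1.1.** An *orthoalgebra* is a set $A$ with constants $0,1$, a unary operation $'$ and a partial binary operation $\oplus$ such that $\oplus$ is commutative and associative (if one side of $a\oplus b=b\oplus a$ or $(a\oplus b)\oplus c=a\oplus(b\oplus c)$ is defined, so is the other, and they are equal), $a'$ is the unique element with $a\oplus a'$ defined and equal to $1$, and $a\oplus a$ is defined if and only if $a=0$. Put $a\le c$ if $a\oplus b=c$ for some $b$. It is *Boolean* if it arises from a Boolean algebra by restricting the join to pairs of orthogonal elements. A *Boolean subalgebra* of $A$ is a subset that contains $0,1$, is closed under $'$ and under existing sums, and is a Boolean orthoalgebra; $\mathrm{BSub}(A)$ is the poset of these under inclusion. $A$ is *proper* if every maximal Boolean subalgebra (block) has more than $4$ elements. An *orthoalgebra isomorphism* is a bijection that, like its inverse, preserves $'$ and every defined sum. An element of a poset with least element $\bot$ is *basic* if it is $\bot$ or an atom; $\lessdot$ is the covering relation, $\mathord\downarrow x=\{w\mid w\le x\}$ and $\mathord\uparrow x=\{y\mid x\le y\}$. A *Boolean domain* is an algebraic lattice in which $\mathord\downarrow x$ is, for each compact $x$, isomorphic to the lattice of partitions of a finite set, ordered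 so that the one-class partition is the least element. An *orthodomain* is a poset $X$ with least element such that every directed subset has a join; every element is the join of the atoms below it, and atoms are compact; each $\mathord\downarrow x$ is a Boolean domain; and if $x,y$ are distinct atoms with $x,y\lessdot w$, then $x\vee y=w$. An element $x$ of a lattice is *dual modular* if $(x\vee y)\wedge z=x\vee(y\wedge z)$ for all $y$ and all $z\ge x$, and $(w\vee x)\wedge y=w\vee(x\wedge y)$ for all $y$ and all $w\le y$. A *principal pair* for $x$ in a Boolean domain with largest element $\top$ is a pair $(y,z)$ of dual modular elements with $y\wedge z=x$ such that $y=\top$ and $z$ is basic, or $z=\top$ and $y$ is basic, or $y\vee z=\top$ and $y\wedge z$ is basic and not dual modular. A *direction* for a basic element $x$ of an orthodomain $X$ is a map $d:\mathord\uparrow x\to X^2$ such that for all $y,z\in\mathord\uparrow x$: (1) $d(y)$ is a principal pair for $x$ in $\mathord\downarrow y$; (2) if $y\le z$ and $d(z)=(v,w)$, then $d(y)=(y\wedge v,y\wedge w)$; (3) if $x\lessdot y,z$, $d(y)=(x,y)$ and $d(z)=(z,x)$, then $y\vee z$ exists and $y,z\lessdot y\vee z$. Let $\mathrm{oDir}(X)$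 be the set of directions for basic elements of $X$. $X$ *has enough directions* if no maximal element of $X$ is basic and each basic element has a direction. On $\mathrm{oDir}(X)$, let $0$ and $1$ be the directions for $\bot$ with $0(w)=(\bot,w)$ and $1(w)=(w,\bot)$, let $d'(w)=(z,y)$ when $d(w)=(y,z)$, and let $\oplus$ be given by exactly the following cases: $d\oplus 0=d=0\oplus d$; $d\oplus d'=1$; and if $d,e$ are directions for distinct atoms $x,y$ whose join $w=x\vee y$ exists and covers both, $d(w)=(x,w)$ and $e(w)=(y,w)$, then $d\oplus e$ is the direction for the third atom $z$ below $w$ with $(d\oplus e)(w)=(w,z)$. For $a\in A$ let $x_a=\{0,a,a',1\}$, and for $y\in\mathord\uparrow x_a$ in $\mathrm{BSub}(A)$ let $$d_a(y)=\bigl(\mathord\downarrow_y a\cup\mathord\uparrow_y a',\ \mathord\downarrow_y a'\cup\mathord\uparrow_y a\bigr),$$ where $\mathord\downarrow_y a=\{b\in y\mid b\le a\}$ and $\mathord\uparrow_y a=\{b\in y\mid a\le b\}$. Let $A$ be a proper orthoalgebra. Then $\mathrm{BSub}(A)$ is an orthodomain with enough directions, $\mathrm{oDir}(\mathrm{BSub}(A))$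 with the operations above is an orthoalgebra, each $d_a$ is a direction of $\mathrm{BSub}(A)$, and $a\mapsto d_a$ is an orthoalgebra isomorphism from $A$ to $\mathrm{oDir}(\mathrm{BSub}(A))$. -/

import Mathlib

universe u

/-! ## Orthoalgebras -/

/-- The signature of orthoalgebras: constants `0`, `1`, a unary operation `'` (written `oc`) and
a partial binary operation `⊕`, given by its graph: `OSum a b c` says that `a ⊕ b` is defined and
equal to `c`. That the graph is single-valued is the first axiom of `IsOrthoalgebra`. -/
class OrthoOps (A : Type u) extends Zero A, One A where
  /-- the orthocomplement `a'` -/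
  oc : A → A
  /-- the graph of the partial operation `⊕` -/
  OSum : A → A → A → Prop

/-- The axioms of an orthoalgebra. -/
class IsOrthoalgebra (A : Type u) [OrthoOps A] : Prop where
  /-- `⊕` is a partial function -/
  sum_unique : ∀ a b c d : A, OrthoOps.OSum a b c → OrthoOps.OSum a b d → c = d
  /-- `⊕` is commutative: if `a ⊕ b` is defined, so is `b ⊕ a`, and they are equal -/
  sum_comm : ∀ a b c : A, OrthoOps.OSum a b c → OrthoOps.OSum b a c
  /-- `⊕` is associative: if one of `(a ⊕ b) ⊕ c` and `a ⊕ (b ⊕ c)` is defined, so is the other,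
  and they are equal -/
  sum_assoc : ∀ a b c s : A,
    (∃ p, OrthoOps.OSum a b p ∧ OrthoOps.OSum p c s) ↔
      (∃ q, OrthoOps.OSum b c q ∧ OrthoOps.OSum a q s)
  /-- `a'` is the unique element with `a ⊕ a'` defined and equal to `1` -/
  sum_eq_one_iff : ∀ a b : A, OrthoOps.OSum a b 1 ↔ b = OrthoOps.oc a
  /-- `a ⊕ a` is defined if and only if `a = 0` -/
  sum_self_iff : ∀ a : A, (∃ c, OrthoOps.OSum a a c) ↔ a = 0

/-- The partial order of an orthoalgebra: `a ≤ c` if `a ⊕ b = c` for some `b`. -/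
def OrthoLE {A : Type u} [OrthoOps A] (a c : A) : Prop :=
  ∃ b, OrthoOps.OSum a b c

/-- Orthoalgebra morphisms: functions that preserve orthocomplements, and sums that are defined. -/
structure IsOrthoMorphism {A C : Type*} [OrthoOps A] [OrthoOps C] (f : A → C) : Prop where
  map_oc : ∀ a : A, f (OrthoOps.oc a) = OrthoOps.oc (f a)
  map_sum : ∀ a b c : A, OrthoOps.OSum a b c → OrthoOps.OSum (f a) (f b) (f c)

/-- Orthoalgebra isomorphisms: morphisms with a set-theoretic inverse that is a morphism. -/
def IsOrthoIso {A C : Type*} [OrthoOps A] [OrthoOps C] (f : A → C) : Prop :=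
  IsOrthoMorphism f ∧ ∃ g : C → A,
    IsOrthoMorphism g ∧ Function.LeftInverse g f ∧ Function.RightInverse g f

/-- An orthoalgebra is Boolean when it arises from a Boolean algebra (on the same set, with the
same `0`, `1` and complement) by restricting the join to pairs of orthogonal elements. -/
def IsBooleanOrtho (A : Type u) [OrthoOps A] : Prop :=
  ∃ _ : BooleanAlgebra A,
    (0 : A) = ⊥ ∧ (1 : A) = ⊤ ∧ (∀ a : A, OrthoOps.oc a = aᶜ) ∧
      ∀ a b c : A, OrthoOps.OSum a b c ↔ a ⊓ b = ⊥ ∧ a ⊔ b = c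

/-- Subalgebras of an orthoalgebra. -/
@[ext]
structure OrthoSubalgebra (A : Type u) [OrthoOps A] where
  carrier : Set A
  zero_mem : 0 ∈ carrier
  one_mem : 1 ∈ carrier
  oc_mem : ∀ a, a ∈ carrier → OrthoOps.oc a ∈ carrier
  sum_mem : ∀ a b c, a ∈ carrier → b ∈ carrier → OrthoOps.OSum a b c → c ∈ carrier

/-- The operations of `A` restricted to a subalgebra. -/
instance OrthoSubalgebra.instOrthoOps {A : Type u} [OrthoOps A] (S : OrthoSubalgebra A) :
    OrthoOps S.carrier where
  zero := ⟨0, S.zero_mem⟩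
  one := ⟨1, S.one_mem⟩
  oc a := ⟨OrthoOps.oc a.1, S.oc_mem a.1 a.2⟩
  OSum a b c := OrthoOps.OSum a.1 b.1 c.1

/-- A subalgebra is Boolean if it is a Boolean orthoalgebra with the restricted operations. -/
def OrthoSubalgebra.IsBoolean {A : Type u} [OrthoOps A] (S : OrthoSubalgebra A) : Prop :=
  IsBooleanOrtho S.carrier

/-- `BSub A`: the Boolean subalgebras of `A`. -/
@[ext]
structure BSub (A : Type u) [OrthoOps A] extends OrthoSubalgebra A where
  boolean : toOrthoSubalgebra.IsBoolean

/-- Boolean subalgebras are ordered by inclusion. -/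
instance BSub.instPartialOrder {A : Type u} [OrthoOps A] : PartialOrder (BSub A) :=
  PartialOrder.lift (fun S => S.carrier) (fun _ _ h => BSub.ext h)

/-- A block is a maximal Boolean subalgebra; an orthoalgebra is proper if each of its blocks has
more than `4` elements. -/
def IsProperOrtho (A : Type u) [OrthoOps A] : Prop :=
  ∀ B : BSub A, IsMax B → 4 < B.carrier.encard

/-! ### The least Boolean subalgebra `{0, 1}` -/

section Bottom

variable {A : Type u} [OrthoOps A] [IsOrthoalgebra A]

open OrthoOps IsOrthoalgebra

theorem ortho_oc_one : oc (1 : A) = 0 := by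
  obtain ⟨c, hc⟩ : ∃ c, OSum (oc (1 : A)) (oc 1) c := by
    have h1 : OSum (1 : A) (oc 1) 1 := (sum_eq_one_iff _ _).2 rfl
    obtain ⟨q, hq, _⟩ := (sum_assoc (1 : A) (oc 1) (oc 1) 1).1 ⟨1, h1, h1⟩
    exact ⟨q, hq⟩
  exact (sum_self_iff _).1 ⟨c, hc⟩

theorem ortho_sum_zero (a : A) : OSum a 0 a := by
  have h1 : OSum (oc a) a 1 := sum_comm _ _ _ ((sum_eq_one_iff _ _).2 rfl)
  have h2 : OSum (1 : A) 0 1 := (sum_eq_one_iff _ _).2 ortho_oc_one.symm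
  obtain ⟨q, hq, hq'⟩ := (sum_assoc (oc a) a 0 1).1 ⟨1, h1, h2⟩
  have e1 := (sum_eq_one_iff _ _).1 hq'
  have e2 := (sum_eq_one_iff _ _).1 h1
  rw [e1, ← e2] at hq
  exact hq

theorem ortho_oc_zero : oc (0 : A) = 1 :=
  ((sum_eq_one_iff _ _).1 (sum_comm _ _ _ (ortho_sum_zero (1 : A)))).symm

/-- The subalgebra `{0, 1}`. -/
def OrthoSubalgebra.bot (A : Type u) [OrthoOps A] [IsOrthoalgebra A] : OrthoSubalgebra A where
  carrier := {0, 1}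
  zero_mem := by simp
  one_mem := by simp
  oc_mem := by
    rintro a (rfl | rfl)
    · simp [ortho_oc_zero]
    · simp [ortho_oc_one]
  sum_mem := by
    rintro a b c (rfl | rfl) (rfl | rfl) h
    · exact Or.inl (sum_unique _ _ _ _ h (ortho_sum_zero 0))
    · exact Or.inr (sum_unique _ _ _ _ h (sum_comm _ _ _ (ortho_sum_zero 1)))
    · exact Or.inr (sum_unique _ _ _ _ h (ortho_sum_zero 1))
    · have h0 : (1 : A) = 0 := (sum_self_iff _).1 ⟨c, h⟩
      rw [h0] at h
      exact Or.inl (sum_unique _ _ _ _ h (ortho_sum_zero 0))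

theorem isBooleanOrtho_of_equiv {P B : Type*} [OrthoOps P] [BooleanAlgebra B] (e : P ≃ B)
    (h0 : e 0 = ⊥) (h1 : e 1 = ⊤) (hc : ∀ a, e (oc a) = (e a)ᶜ)
    (hs : ∀ a b c, OSum a b c ↔ e a ⊓ e b = ⊥ ∧ e a ⊔ e b = e c) : IsBooleanOrtho P := by
  refine ⟨e.booleanAlgebra, ?_, ?_, ?_, ?_⟩
  · exact e.injective (h0.trans (e.apply_symm_apply _).symm)
  · exact e.injective (h1.trans (e.apply_symm_apply _).symm)
  · intro a
    exact e.injective ((hc a).trans (e.apply_symm_apply _).symm)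
  · intro a b c
    rw [hs]
    refine and_congr ?_ ?_
    · exact ⟨fun h => congrArg e.symm h, fun h => e.symm.injective h⟩
    · exact ⟨fun h => (congrArg e.symm h).trans (e.symm_apply_apply c),
        fun h => e.symm.injective (h.trans (e.symm_apply_apply c).symm)⟩

theorem OrthoSubalgebra.bot_isBoolean : (OrthoSubalgebra.bot A).IsBoolean := by
  classical
  by_cases h01 : (0 : A) = 1
  · have hsub : ∀ a b : (OrthoSubalgebra.bot A).carrier, a = b := by
      rintro ⟨a, rfl | rfl⟩ ⟨b, rfl | rfl⟩ <;> simp [h01]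
    let e : (OrthoSubalgebra.bot A).carrier ≃ PUnit.{1} :=
      { toFun := fun _ => ⟨⟩, invFun := fun _ => 0, left_inv := fun _ => hsub _ _,
        right_inv := fun _ => rfl }
    refine isBooleanOrtho_of_equiv e rfl rfl (fun _ => rfl) fun a b c => ?_
    rw [hsub a 0, hsub b 0, hsub c 0]
    exact ⟨fun _ => ⟨rfl, rfl⟩, fun _ => ortho_sum_zero (0 : A)⟩
  · have h10 : (1 : A) ≠ 0 := fun h => h01 h.symm
    let e : (OrthoSubalgebra.bot A).carrier ≃ Bool :=
      { toFun := fun a => decide (a.1 = 1)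
        invFun := fun b => if b then 1 else 0
        left_inv := by
          rintro ⟨a, rfl | rfl⟩
          · simp only [h01, decide_false, Bool.false_eq_true, if_false]; rfl
          · simp only [decide_true, if_true]; rfl
        right_inv := by
          rintro (_ | _)
          · exact decide_eq_false h01
          · exact decide_eq_true rfl }
    have e0 : e 0 = false := decide_eq_false h01
    have e1 : e 1 = true := decide_eq_true rfl
    have hcase : ∀ a : (OrthoSubalgebra.bot A).carrier, a = 0 ∨ a = 1 := by
      rintro ⟨a, rfl | rfl⟩
      · exact Or.inl rfl
      · exact Or.inr rfl
    have c0 : oc (0 : (OrthoSubalgebra.bot A).carrier) = 1 := Subtype.ext ortho_oc_zero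
    have c1 : oc (1 : (OrthoSubalgebra.bot A).carrier) = 0 := Subtype.ext ortho_oc_one
    refine isBooleanOrtho_of_equiv e e0 e1 ?_ ?_
    · intro a
      rcases hcase a with rfl | rfl
      · rw [c0, e0, e1]; rfl
      · rw [c1, e0, e1]; rfl
    · intro a b c
      have s00 : OSum (0 : A) 0 0 := ortho_sum_zero 0
      have s10 : OSum (1 : A) 0 1 := ortho_sum_zero 1
      have s01 : OSum (0 : A) 1 1 := sum_comm _ _ _ s10
      rcases hcase a with rfl | rfl <;> rcases hcase b with rfl | rfl <;>
        rcases hcase c with rfl | rfl <;> simp only [e0, e1] <;> simp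
      · exact s00
      · exact fun h => h01 (sum_unique _ _ _ _ s00 h)
      · exact fun h => h10 (sum_unique _ _ _ _ s01 h)
      · exact s01
      · exact fun h => h10 (sum_unique _ _ _ _ s10 h)
      · exact s10
      · exact fun h => h10 ((sum_self_iff (1 : A)).1 ⟨_, h⟩)
      · exact fun h => h10 ((sum_self_iff (1 : A)).1 ⟨_, h⟩)

/-- The least element of `BSub A` is `{0, 1}`. -/
instance BSub.instOrderBot : OrderBot (BSub A) where
  bot := ⟨OrthoSubalgebra.bot A, OrthoSubalgebra.bot_isBoolean⟩
  bot_le S := by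
    rintro a (rfl | rfl)
    · exact S.zero_mem
    · exact S.one_mem

end Bottom

/-! ## Boolean domains and orthodomains -/

/-- Compact elements of a poset: if `x` lies below the join of a (nonempty) directed set, then it
lies below one of its members. -/
def IsCompactIn {X : Type u} [PartialOrder X] (x : X) : Prop :=
  ∀ D : Set X, D.Nonempty → DirectedOn (· ≤ ·) D → ∀ s, IsLUB D s → x ≤ s → ∃ y ∈ D, x ≤ y

/-- Boolean domains: algebraic lattices in which `↓x` is a finite partition lattice for each
compact `x`. The lattice of partitions of a set has the partition with a single class at the
bottom here, so that the subalgebra lattice of a finite Boolean algebra is a partition lattice;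
this is the dual of Mathlib's order on `Setoid`. -/
def IsBooleanDomain (X : Type u) [PartialOrder X] : Prop :=
  (∀ S : Set X, ∃ s, IsLUB S s) ∧
  (∀ x : X, IsLUB {k | IsCompactIn k ∧ k ≤ x} x) ∧
  (∀ x : X, IsCompactIn x → ∃ n : ℕ, Nonempty (Set.Iic x ≃o (Setoid (Fin n))ᵒᵈ))

/-- Orthodomains. -/
structure IsOrthodomain (X : Type u) [PartialOrder X] [OrderBot X] : Prop where
  directed_join : ∀ D : Set X, D.Nonempty → DirectedOn (· ≤ ·) D → ∃ s, IsLUB D s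
  atomistic : ∀ x : X, IsLUB {a | IsAtom a ∧ a ≤ x} x
  atom_compact : ∀ a : X, IsAtom a → IsCompactIn a
  ideal_boolean : ∀ x : X, IsBooleanDomain (Set.Iic x)
  join_of_cover : ∀ x y w : X, IsAtom x → IsAtom y → x ≠ y → x ⋖ w → y ⋖ w → IsLUB {x, y} w

/-- Basic elements: the least element and the atoms. -/
def IsBasic {X : Type u} [PartialOrder X] [OrderBot X] (x : X) : Prop :=
  x = ⊥ ∨ IsAtom x

/-- Dual modular elements of a lattice: `(x ∨ y) ∧ z = x ∨ (y ∧ z)` for all `y` and all `z ≥ x`,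
and `(w ∨ x) ∧ y = w ∨ (x ∧ y)` for all `y` and all `w ≤ y`. The lattice is given as a poset, and
its joins and meets are written as least upper and greatest lower bounds. -/
def IsDualModular {X : Type u} [PartialOrder X] (x : X) : Prop :=
  (∀ y z : X, x ≤ z → ∀ s l m r : X,
    IsLUB {x, y} s → IsGLB {s, z} l → IsGLB {y, z} m → IsLUB {x, m} r → l = r) ∧
  (∀ w y : X, w ≤ y → ∀ s l m r : X,
    IsLUB {w, x} s → IsGLB {s, y} l → IsGLB {x, y} m → IsLUB {w, m} r → l = r)

/-- Principal pairs of a Boolean domain. -/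
def IsPrincipalPair {X : Type u} [PartialOrder X] [OrderBot X] [OrderTop X] (y z : X) : Prop :=
  IsDualModular y ∧ IsDualModular z ∧
    ((y = ⊤ ∧ IsBasic z) ∨ (z = ⊤ ∧ IsBasic y) ∨
      (IsLUB {y, z} ⊤ ∧ ∃ m, IsGLB {y, z} m ∧ IsBasic m ∧ ¬ IsDualModular m))

/-- `(y, z)` is a principal pair for `x`: a principal pair with `y ∧ z = x`. -/
def IsPrincipalPairFor {X : Type u} [PartialOrder X] [OrderBot X] [OrderTop X] (x y z : X) :
    Prop :=
  IsPrincipalPair y z ∧ IsGLB {y, z} x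

/-! ## Directions -/

/-- `oDir X`: the directions of `X`, that is, the maps `d : ↑x → X²`, for basic `x`, such that
for all `y, z ≥ x` the three conditions hold. -/
structure ODir (X : Type u) [PartialOrder X] [OrderBot X] where
  /-- the element `x` that `d` is a direction for -/
  base : X
  basic : IsBasic base
  /-- the map `d : ↑x → X²` -/
  val : Set.Ici base → X × X
  /-- `d(y)` is a principal pair for `x` in the Boolean domain `↓y` -/
  principal : ∀ y : Set.Ici base, ∃ (h₁ : (val y).1 ≤ y.1) (h₂ : (val y).2 ≤ y.1),
    IsPrincipalPairFor (X := Set.Iic y.1) ⟨base, y.2⟩ ⟨(val y).1, h₁⟩ ⟨(val y).2, h₂⟩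
  /-- if `y ≤ z` and `d(z) = (v, w)`, then `d(y) = (y ∧ v, y ∧ w)` -/
  restrict : ∀ y z : Set.Ici base, y ≤ z →
    IsGLB {y.1, (val z).1} (val y).1 ∧ IsGLB {y.1, (val z).2} (val y).2
  /-- if `y, z` cover `x`, `d(y) = (x, y)` and `d(z) = (z, x)`, then `y ∨ z` exists and covers
  `y` and `z` -/
  cover : ∀ y z : Set.Ici base, base ⋖ y.1 → base ⋖ z.1 →
    val y = (base, y.1) → val z = (z.1, base) →
      ∃ u, IsLUB {y.1, z.1} u ∧ y.1 ⋖ u ∧ z.1 ⋖ u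

/-- An orthodomain is proper if none of its maximal elements is basic. It has enough directions if
it is proper and each basic element has a direction. -/
structure HasEnoughDirections (X : Type u) [PartialOrder X] [OrderBot X] : Prop where
  orthodomain : IsOrthodomain X
  proper : ∀ x : X, IsMax x → ¬ IsBasic x
  exists_direction : ∀ x : X, IsBasic x → ∃ d : ODir X, d.base = x

/-- Near atoms with join `w`: `x` and `y` are distinct atoms, and their join exists, is equal to
`w` and covers both. -/
def IsNearWith {X : Type u} [PartialOrder X] [OrderBot X] (x y w : X) : Prop :=
  IsAtom x ∧ IsAtom y ∧ x ≠ y ∧ IsLUB {x, y} w ∧ x ⋖ w ∧ y ⋖ w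

theorem isDualModular_bot {X : Type u} [PartialOrder X] [OrderBot X] :
    IsDualModular (⊥ : X) := by
  constructor
  · intro y z _ s l m r hs hl hm hr
    have h1 : s = y := hs.unique ⟨by simp [upperBounds], fun b hb => hb (by simp)⟩
    have h2 : r = m := hr.unique ⟨by simp [upperBounds], fun b hb => hb (by simp)⟩
    subst h1 h2
    exact hl.unique hm
  · intro w y hwy s l m r hs hl hm hr
    have h1 : s = w := hs.unique ⟨by simp [upperBounds], fun b hb => hb (by simp)⟩
    have h2 : m = ⊥ := le_bot_iff.1 (hm.1 (by simp))
    subst h1 h2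
    have h3 : r = s := hr.unique ⟨by simp [upperBounds], fun b hb => hb (by simp)⟩
    subst h3
    exact hl.unique ⟨by simp [lowerBounds, hwy], fun b hb => hb (by simp)⟩

theorem isDualModular_top {X : Type u} [PartialOrder X] [OrderTop X] :
    IsDualModular (⊤ : X) := by
  constructor
  · intro y z hz s l m r hs hl hm hr
    have h0 : z = ⊤ := top_le_iff.1 hz
    have h1 : s = ⊤ := top_le_iff.1 (hs.1 (by simp))
    have h2 : r = ⊤ := top_le_iff.1 (hr.1 (by simp))
    subst h0 h1 h2
    exact hl.unique ⟨by simp [lowerBounds], fun b hb => hb (by simp)⟩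
  · intro w y hwy s l m r hs hl hm hr
    have h1 : s = ⊤ := top_le_iff.1 (hs.1 (by simp))
    subst h1
    have h2 : l = y := hl.unique ⟨by simp [lowerBounds], fun b hb => hb (by simp)⟩
    have h3 : m = y := hm.unique ⟨by simp [lowerBounds], fun b hb => hb (by simp)⟩
    subst h2 h3
    exact (hr.unique ⟨by simp [upperBounds, hwy], fun b hb => hb (by simp)⟩).symm

theorem IsPrincipalPairFor.swap {X : Type u} [PartialOrder X] [OrderBot X] [OrderTop X]
    {x y z : X} (h : IsPrincipalPairFor x y z) : IsPrincipalPairFor x z y := by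
  obtain ⟨⟨hy, hz, h⟩, hx⟩ := h
  refine ⟨⟨hz, hy, ?_⟩, by rwa [Set.pair_comm]⟩
  rw [Set.pair_comm z y]
  tauto

/-- The complement `d'` of a direction `d`: `d'(w) = (z, y)` if `d(w) = (y, z)`. -/
def ODir.compl {X : Type u} [PartialOrder X] [OrderBot X] (d : ODir X) : ODir X where
  base := d.base
  basic := d.basic
  val y := ((d.val y).2, (d.val y).1)
  principal y := by
    obtain ⟨h₁, h₂, h⟩ := d.principal y
    exact ⟨h₂, h₁, h.swap⟩
  restrict y z h := (d.restrict y z h).symm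
  cover y z hy hz h₁ h₂ := by
    have h₁' : d.val y = (y.1, d.base) := by
      rw [Prod.mk.injEq] at h₁; exact Prod.ext h₁.2 h₁.1
    have h₂' : d.val z = (d.base, z.1) := by
      rw [Prod.mk.injEq] at h₂; exact Prod.ext h₂.2 h₂.1
    obtain ⟨u, hu, hzu, hyu⟩ := d.cover z y hz hy h₂' h₁'
    exact ⟨u, by rwa [Set.pair_comm], hyu, hzu⟩

/-- The direction `0` for `⊥`: `0(w) = (⊥, w)`. -/
def ODir.zero (X : Type u) [PartialOrder X] [OrderBot X] : ODir X where
  base := ⊥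
  basic := Or.inl rfl
  val y := (⊥, y.1)
  principal y := by
    refine ⟨bot_le, le_rfl, ⟨isDualModular_bot, isDualModular_top, ?_⟩, ?_⟩
    · exact Or.inr (Or.inl ⟨rfl, Or.inl rfl⟩)
    · exact ⟨fun b _ => (bot_le : (⊥ : X) ≤ b.1), fun b hb => hb (Set.mem_insert _ _)⟩
  restrict y z h := by
    refine ⟨⟨fun b _ => bot_le, fun b hb => hb (by simp)⟩, ⟨?_, fun b hb => hb (by simp)⟩⟩
    rintro b (rfl | rfl)
    · exact le_rfl
    · exact h
  cover y z _ hz _ h := by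
    rw [Prod.mk.injEq] at h
    exact absurd h.1 hz.lt.ne

/-- The direction `1` for `⊥`: `1(w) = (w, ⊥)`. -/
def ODir.one (X : Type u) [PartialOrder X] [OrderBot X] : ODir X :=
  (ODir.zero X).compl

/-- The operations `0`, `1`, `'` and `⊕` on the directions. A sum `d ⊕ e = f` is defined in the
cases `d ⊕ 0 = d`, `0 ⊕ e = e`, `d ⊕ d' = 1`, and the following: `d` is a direction for `x` and
`e` is one for `y`, where `x, y` are near with join `w`; `d(w) = (x, w)` and `e(w) = (y, w)`; and
`f` is the direction for the third atom `z` beneath `w` with `f(w) = (w, z)`. -/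
instance ODir.instOrthoOps {X : Type u} [PartialOrder X] [OrderBot X] : OrthoOps (ODir X) where
  zero := ODir.zero X
  one := ODir.one X
  oc := ODir.compl
  OSum d e f :=
    (e = ODir.zero X ∧ f = d) ∨ (d = ODir.zero X ∧ f = e) ∨ (e = d.compl ∧ f = ODir.one X) ∨
      ∃ (w : X) (hd : d.base ≤ w) (he : e.base ≤ w) (hf : f.base ≤ w),
        IsNearWith d.base e.base w ∧
        d.val ⟨w, hd⟩ = (d.base, w) ∧ e.val ⟨w, he⟩ = (e.base, w) ∧
        IsAtom f.base ∧ f.base ≠ d.base ∧ f.base ≠ e.base ∧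
        f.val ⟨w, hf⟩ = (w, f.base)

/-! ## The direction corresponding to an element -/

/-- `d` is the direction `d_a` corresponding to the element `a`: it is a direction for
`x_a = {0, a, a', 1}`, and `d(y) = (↓_y a ∪ ↑_y a', ↓_y a' ∪ ↑_y a)` for all `y ≥ x_a`, where
`↓_y a = {b ∈ y | b ≤ a}` and `↑_y a = {b ∈ y | a ≤ b}`. -/
def IsDirectionOf {A : Type u} [OrthoOps A] [IsOrthoalgebra A] (a : A) (d : ODir (BSub A)) :
    Prop :=
  d.base.carrier = {0, a, OrthoOps.oc a, 1} ∧
  ∀ y : Set.Ici d.base,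
    (d.val y).1.carrier =
      {b | b ∈ y.1.carrier ∧ OrthoLE b a} ∪ {b | b ∈ y.1.carrier ∧ OrthoLE (OrthoOps.oc a) b} ∧
    (d.val y).2.carrier =
      {b | b ∈ y.1.carrier ∧ OrthoLE b (OrthoOps.oc a)} ∪ {b | b ∈ y.1.carrier ∧ OrthoLE a b}

set_option linter.unusedSectionVars false

/-! A basic element of `BSub A` has the form `{0, a, a', 1}`, so it determines `a` only up to
complement. A direction supplies the missing bit.

For a Boolean subalgebra `y`, the ideal `↓y` of `BSub A` is the subalgebra lattice of the Boolean
algebra `y` (`BSub.iicIso`). If `Y` is dual modular there and `p ∈ Y`, then `Y` contains every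
element below `p` or every element below `pᶜ` (`below_subset_of_isDualModular`). Hence a principal
pair for `{0, a, a', 1}` consists of the subalgebras `↓a ∪ ↑a'` and `↓a' ∪ ↑a`, in one of the two
orders (`isPrincipalPairFor_gen_iff`). So at each `y` a direction chooses between `a` and `a'`.

Condition (2) carries the choice downwards. It remains to compare two covers of `{0, a, a', 1}`. If
opposite choices were made there, the covers would still have an upper bound: condition (3) gives
one when they add elements on the same side of `a`, and gluing an interval of each gives one when
they add elements on different sides (`exists_common_cover`). The choice at the upper bound would
restrict to both covers, a contradiction. Properness provides at least one cover, where the two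
choices really differ. Thus `a ↦ d_a` is a bijection.

A nontrivial sum `a ⊕ b ≠ 1` spans an eight-element Boolean subalgebra with atoms `a`, `b`, `(a ⊕
b)'`, and the values of the directions there say which of the elements are atoms. So sums are
preserved and reflected, and the orthoalgebra axioms transfer along the bijection. For the
orthodomain axioms, a Mackey decomposition criterion shows that directed unions of Boolean
subalgebras are Boolean, and finite Boolean algebras are power sets, whose subalgebras are
partitions. -/

namespace Ortho

open OrthoOps IsOrthoalgebra

/-! ### Arithmetic and order in an orthoalgebra, and a criterion for being Boolean. -/

section Basic

variable {A : Type*} [OrthoOps A] [IsOrthoalgebra A] {a b c d s p q x : A}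

theorem sum_oc (a : A) : OSum a (oc a) 1 := (sum_eq_one_iff _ _).2 rfl

theorem comm (h : OSum a b c) : OSum b a c := sum_comm _ _ _ h

theorem uniq (h : OSum a b c) (h' : OSum a b d) : c = d := sum_unique _ _ _ _ h h'

@[simp] theorem oc_oc (a : A) : oc (oc a) = a :=
  ((sum_eq_one_iff _ _).1 (comm (sum_oc a))).symm

theorem oc_inj : oc a = oc b ↔ a = b :=
  ⟨fun h => by rw [← oc_oc a, h, oc_oc], fun h => h ▸ rfl⟩

theorem oc_eq_comm : oc a = b ↔ a = oc b := by rw [← oc_inj, oc_oc]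

theorem zero_sum (a : A) : OSum 0 a a := comm (ortho_sum_zero a)

theorem assoc_right (h : OSum a b p) (h' : OSum p c s) : ∃ q, OSum b c q ∧ OSum a q s :=
  (sum_assoc _ _ _ _).1 ⟨p, h, h'⟩

theorem assoc_left (h : OSum b c q) (h' : OSum a q s) : ∃ p, OSum a b p ∧ OSum p c s :=
  (sum_assoc _ _ _ _).2 ⟨q, h, h'⟩

/-- The elements `a`, `b`, `c'` sum to `1`, so their roles can be permuted; cancellation, order
reversal and the symmetry of `eight` rest on this. -/
theorem rotate (h : OSum a b c) : OSum b (oc c) (oc a) := by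
  obtain ⟨q, hq, hq'⟩ := assoc_right h (sum_oc c)
  rwa [← (sum_eq_one_iff _ _).1 hq']

theorem cancel (h : OSum a b c) (h' : OSum a d c) : b = d :=
  oc_inj.1 (uniq (rotate (comm h)) (rotate (comm h')))

theorem sum_zero_iff : OSum a 0 b ↔ b = a :=
  ⟨fun h => uniq h (ortho_sum_zero a), fun h => h ▸ ortho_sum_zero a⟩

theorem eq_zero_of_sum_self (h : OSum a a c) : a = 0 := (sum_self_iff _).1 ⟨c, h⟩

theorem ole_refl (a : A) : OrthoLE a a := ⟨0, ortho_sum_zero a⟩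

theorem zero_ole (a : A) : OrthoLE 0 a := ⟨a, zero_sum a⟩

theorem ole_one (a : A) : OrthoLE a 1 := ⟨oc a, sum_oc a⟩

theorem le_sum_left (h : OSum a b c) : OrthoLE a c := ⟨b, h⟩

theorem le_sum_right (h : OSum a b c) : OrthoLE b c := ⟨a, comm h⟩

theorem ole_trans (h : OrthoLE a b) (h' : OrthoLE b c) : OrthoLE a c := by
  obtain ⟨x, hx⟩ := h
  obtain ⟨y, hy⟩ := h'
  obtain ⟨q, -, hq⟩ := assoc_right hx hy
  exact ⟨q, hq⟩

theorem orth_iff : (∃ c, OSum a b c) ↔ OrthoLE b (oc a) := by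
  constructor
  · rintro ⟨c, h⟩
    exact ⟨_, rotate h⟩
  · rintro ⟨d, h⟩
    have := rotate (comm h)
    rw [oc_oc] at this
    exact ⟨_, comm this⟩

theorem oc_le_oc (h : OrthoLE a b) : OrthoLE (oc b) (oc a) := by
  obtain ⟨d, h⟩ := h
  exact le_sum_right (rotate h)

theorem oc_le_oc_iff : OrthoLE (oc b) (oc a) ↔ OrthoLE a b :=
  ⟨fun h => by simpa using oc_le_oc h, oc_le_oc⟩

theorem oc_le_iff : OrthoLE (oc a) b ↔ OrthoLE (oc b) a := by
  rw [← oc_le_oc_iff, oc_oc]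

theorem le_oc_iff : OrthoLE a (oc b) ↔ OrthoLE b (oc a) := by
  rw [← oc_le_oc_iff, oc_oc]

theorem sum_mono (h : OSum a b c) {a₀ b₀ : A} (ha : OrthoLE a₀ a) (hb : OrthoLE b₀ b) :
    ∃ c₀, OSum a₀ b₀ c₀ ∧ OrthoLE c₀ c := by
  obtain ⟨x, hx⟩ := ha
  obtain ⟨y, hy⟩ := hb
  obtain ⟨q, hq, hq'⟩ := assoc_right (comm hx) h
  obtain ⟨r, hr, hr'⟩ := assoc_left hy hq
  exact ⟨r, hr, ole_trans (le_sum_left hr') (le_sum_right hq')⟩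

theorem eq_zero_of_le_of_le (h : OSum a b c) (ha : OrthoLE x a) (hb : OrthoLE x b) : x = 0 := by
  obtain ⟨_, h, -⟩ := sum_mono h ha hb
  exact eq_zero_of_sum_self h

theorem eq_zero_of_le_oc (ha : OrthoLE x a) (hb : OrthoLE x (oc a)) : x = 0 :=
  eq_zero_of_le_of_le (sum_oc a) ha hb

theorem le_zero (h : OrthoLE a 0) : a = 0 :=
  eq_zero_of_le_of_le (sum_oc a) (ole_refl a)
    (ole_trans h (zero_ole _))

theorem one_le (h : OrthoLE 1 a) : a = 1 := by
  have := oc_le_oc h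
  rw [ortho_oc_one] at this
  rw [← oc_oc a, le_zero this, ortho_oc_zero]

theorem ole_antisymm (h : OrthoLE a b) (h' : OrthoLE b a) : a = b := by
  obtain ⟨x, hx⟩ := h
  obtain ⟨y, hy⟩ := h'
  obtain ⟨q, hq, hq'⟩ := assoc_right hx hy
  have h0 : q = 0 := cancel hq' (ortho_sum_zero a)
  subst h0
  have : x = 0 := le_zero (le_sum_left hq)
  subst this
  exact uniq (ortho_sum_zero a) hx

theorem sum_sum_sum_comm {u v w : A} (h₁ : OSum a b u) (h₂ : OSum c d v) (h : OSum u v w) :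
    ∃ p q, OSum a c p ∧ OSum b d q ∧ OSum p q w := by
  obtain ⟨x, hx, hx'⟩ := assoc_right h₁ h
  obtain ⟨y, hy, hy'⟩ := assoc_left (comm h₂) hx
  obtain ⟨z, hz, hz'⟩ := assoc_left (comm hy') hx'
  exact ⟨z, y, hz, hy, hz'⟩

theorem oc_eq_zero : oc a = 0 ↔ a = 1 := by rw [oc_eq_comm, ortho_oc_zero]

theorem oc_eq_one : oc a = 1 ↔ a = 0 := by rw [oc_eq_comm, ortho_oc_one]

end Basic

/-- An orthoalgebra in which any two elements have a Mackey decomposition over a greatest lower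
bound is Boolean. -/
theorem isBooleanOrtho_of_mackey {P : Type*} [OrthoOps P] [IsOrthoalgebra P]
    (H : ∀ a b : P, ∃ m p q s, OSum m p a ∧ OSum m q b ∧ OSum p q s ∧
      ∀ c, OrthoLE c a → OrthoLE c b → OrthoLE c m) : IsBooleanOrtho P := by
  choose f p q s hp hq hs hf using H
  have fl : ∀ a b, OrthoLE (f a b) a := fun a b => le_sum_left (hp a b)
  have fr : ∀ a b, OrthoLE (f a b) b := fun a b => le_sum_left (hq a b)
  let po : PartialOrder P :=
    { le := OrthoLE, le_refl := ole_refl, le_trans := fun _ _ _ => ole_trans,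
      le_antisymm := fun _ _ => ole_antisymm }
  let lat : Lattice P :=
    { po with
      inf := f
      sup := fun a b => oc (f (oc a) (oc b))
      inf_le_left := fl
      inf_le_right := fr
      le_inf := fun a b c h1 h2 => hf b c a h1 h2
      le_sup_left := fun a b => le_oc_iff.2 (fl _ _)
      le_sup_right := fun a b => le_oc_iff.2 (fr _ _)
      sup_le := fun a b c h1 h2 => oc_le_iff.2 (hf _ _ _ (oc_le_oc h1) (oc_le_oc h2)) }
  -- When the meet vanishes, the two Mackey remainders are `a` and `b` themselves, and these have a
  -- sum.
  have orth : ∀ a b, f a b = 0 → OrthoLE a (oc b) := by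
    intro a b h
    have h1 := hp a b
    have h2 := hq a b
    rw [h] at h1 h2
    have e1 := uniq h1 (zero_sum _)
    have e2 := uniq h2 (zero_sum _)
    have h3 := hs a b
    rw [← e1, ← e2] at h3
    exact orth_iff.1 ⟨_, comm h3⟩
  have le_oc_sup : ∀ x b c : P, OrthoLE x (oc b) → OrthoLE x (oc c) → OrthoLE x (oc (b ⊔ c)) := by
    intro x b c h1 h2
    change OrthoLE x (oc (oc (f (oc b) (oc c))))
    rw [oc_oc]
    exact hf _ _ _ h1 h2
  have dist : ∀ a b c : P, a ⊓ (b ⊔ c) ≤ (a ⊓ b) ⊔ (a ⊓ c) := by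
    intro a b c
    -- Let `x` be below both the left side and the complement of the right side. Its meet with `b`
    -- lies below `a ⊓ b` and below that complement, so it is `0` and `x ≤ b'`. Likewise `x ≤ c'`,
    -- which contradicts `x ≤ b ⊔ c` unless `x = 0`.
    have key : f (a ⊓ (b ⊔ c)) (oc ((a ⊓ b) ⊔ (a ⊓ c))) = 0 := by
      obtain ⟨x, hx⟩ : ∃ x, x = f (a ⊓ (b ⊔ c)) (oc ((a ⊓ b) ⊔ (a ⊓ c))) := ⟨_, rfl⟩
      rw [← hx]
      have hx1 : OrthoLE x (a ⊓ (b ⊔ c)) := hx ▸ fl _ _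
      have hx2 : OrthoLE x (oc ((a ⊓ b) ⊔ (a ⊓ c))) := hx ▸ fr _ _
      have hxa : OrthoLE x a := ole_trans hx1 (fl _ _)
      have aux : ∀ d : P, OrthoLE (a ⊓ d) ((a ⊓ b) ⊔ (a ⊓ c)) → OrthoLE x (oc d) := by
        intro d hd
        refine orth x d (eq_zero_of_le_oc (a := (a ⊓ b) ⊔ (a ⊓ c)) ?_ (ole_trans (fl _ _) hx2))
        exact ole_trans (hf _ _ _ (ole_trans (fl _ _) hxa) (fr _ _)) hd
      exact eq_zero_of_le_oc (ole_trans hx1 (fr _ _))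
        (le_oc_sup x b c (aux b (lat.le_sup_left _ _)) (aux c (lat.le_sup_right _ _)))
    have := orth _ _ key
    rwa [oc_oc] at this
  let dl : DistribLattice P := DistribLattice.ofInfSupLe dist
  let ba : BooleanAlgebra P :=
    { dl with
      compl := oc
      bot := 0
      top := 1
      le_top := ole_one
      bot_le := zero_ole
      inf_compl_le_bot := fun a => by
        change OrthoLE (f a (oc a)) 0
        rw [eq_zero_of_le_oc (fl a (oc a)) (fr a (oc a))]
        exact ole_refl _
      top_le_sup_compl := fun a => by
        change OrthoLE 1 (oc (f (oc a) (oc (oc a))))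
        rw [eq_zero_of_le_oc (fl (oc a) (oc (oc a))) (fr _ _), ortho_oc_zero]
        exact ole_refl _ }
  refine ⟨ba, rfl, rfl, fun _ => rfl, fun a b c => ?_⟩
  have sup_eq : ∀ a b c : P, OSum a b c → a ⊔ b = c := by
    intro a b c h
    refine ole_antisymm (lat.sup_le _ _ _ (le_sum_left h) (le_sum_right h)) ?_
    -- The excess `e` of `c` over the join lies below both `a` and `b` by cancellation, so it is
    -- `0`.
    obtain ⟨e, he⟩ := (lat.sup_le _ _ _ (le_sum_left h) (le_sum_right h) : OrthoLE (a ⊔ b) c)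
    obtain ⟨r, hr⟩ := (lat.le_sup_left a b : OrthoLE a (a ⊔ b))
    obtain ⟨t, ht⟩ := (lat.le_sup_right a b : OrthoLE b (a ⊔ b))
    obtain ⟨u, hu, hu'⟩ := assoc_right hr he
    obtain ⟨v, hv, hv'⟩ := assoc_right ht he
    rw [cancel hu' h] at hu
    rw [cancel hv' (comm h)] at hv
    have : e = 0 := eq_zero_of_le_of_le h (le_sum_right hv) (le_sum_right hu)
    subst this
    rw [sum_zero_iff] at he
    rw [he]
    exact ole_refl _
  constructor
  · intro h
    exact ⟨eq_zero_of_le_of_le h (fl a b) (fr a b), sup_eq a b c h⟩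
  · rintro ⟨h, rfl⟩
    obtain ⟨c, hc⟩ := orth_iff.2 (le_oc_iff.1 (orth a b h))
    rwa [sup_eq a b c hc]

/-- A faithful embedding of a Boolean algebra onto an interval below `t` in an orthoalgebra. -/
structure IsBoolEmb {B A : Type*} [BooleanAlgebra B] [OrthoOps A] (f : B → A) (t : A) : Prop where
  map_sum : ∀ x y, Disjoint x y → OSum (f x) (f y) (f (x ⊔ y))
  map_top : f ⊤ = t
  eq_bot : ∀ x, f x = 0 → x = ⊥

/-! ### Boolean algebras embedded in an orthoalgebra. -/

namespace IsBoolEmb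

variable {A : Type u} [OrthoOps A] [IsOrthoalgebra A] {B C : Type*} [BooleanAlgebra B]
  [BooleanAlgebra C] {f : B → A} {g : C → A} {s t w : A}

theorem map_bot (hf : IsBoolEmb f t) : f ⊥ = 0 := by
  have := hf.map_sum ⊥ ⊥ disjoint_bot_left
  rw [sup_bot_eq] at this
  exact eq_zero_of_sum_self this

theorem le_top (hf : IsBoolEmb f t) (x : B) : OrthoLE (f x) t := by
  have := hf.map_sum x xᶜ disjoint_compl_right
  rw [sup_compl_eq_top, hf.map_top] at this
  exact le_sum_left this

theorem map_compl (hf : IsBoolEmb f 1) (x : B) : f xᶜ = oc (f x) := by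
  have := hf.map_sum x xᶜ disjoint_compl_right
  rw [sup_compl_eq_top, hf.map_top] at this
  exact (sum_eq_one_iff _ _).1 this

theorem mono (hf : IsBoolEmb f t) {x y : B} (h : x ≤ y) : OrthoLE (f x) (f y) := by
  have := hf.map_sum x (y \ x) disjoint_sdiff_self_right
  rw [sup_sdiff_cancel_right h] at this
  exact le_sum_left this

theorem disjoint_of_sum (hf : IsBoolEmb f t) {x y : B} {c : A} (h : OSum (f x) (f y) c) :
    Disjoint x y := by
  rw [disjoint_iff]
  exact hf.eq_bot _ (eq_zero_of_le_of_le h (hf.mono inf_le_left) (hf.mono inf_le_right))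

theorem sum_iff (hf : IsBoolEmb f t) {x y : B} {c : A} :
    OSum (f x) (f y) c ↔ Disjoint x y ∧ f (x ⊔ y) = c :=
  ⟨fun h => ⟨hf.disjoint_of_sum h, uniq (hf.map_sum x y (hf.disjoint_of_sum h)) h⟩,
    fun h => h.2 ▸ hf.map_sum x y h.1⟩

/-- If `f x = f y`, cancelling `f (x ⊓ y)` gives `f (x \ y) = f (y \ x)`. These are images of
disjoint elements, so one value is summable with itself and vanishes. -/
theorem injective (hf : IsBoolEmb f t) : Function.Injective f := by
  have key : ∀ x y, f x = f y → x ≤ y := by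
    intro x y h
    have h1 := hf.map_sum (x ⊓ y) (x \ y)
      (disjoint_sdiff_self_right.mono_left inf_le_right)
    have h2 := hf.map_sum (x ⊓ y) (y \ x)
      (disjoint_sdiff_self_right.mono_left inf_le_left)
    have e1 : x ⊓ y ⊔ x \ y = x := sup_inf_sdiff x y
    have e2 : x ⊓ y ⊔ y \ x = y := by rw [inf_comm]; exact sup_inf_sdiff y x
    rw [e1] at h1
    rw [e2] at h2
    rw [h] at h1
    have h3 := cancel h1 h2
    have h4 := hf.map_sum (x \ y) (y \ x) disjoint_sdiff_sdiff
    rw [← h3] at h4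
    exact sdiff_eq_bot_iff.1 (hf.eq_bot _ (eq_zero_of_sum_self h4))
  exact fun x y h => le_antisymm (key x y h) (key y x h.symm)

/-- The image of a faithful embedding onto the whole orthoalgebra, as a subalgebra. -/
def rangeSubalgebra (hf : IsBoolEmb f 1) : OrthoSubalgebra A where
  carrier := Set.range f
  zero_mem := ⟨⊥, hf.map_bot⟩
  one_mem := ⟨⊤, hf.map_top⟩
  oc_mem := by
    rintro _ ⟨x, rfl⟩
    exact ⟨xᶜ, hf.map_compl x⟩
  sum_mem := by
    rintro _ _ c ⟨x, rfl⟩ ⟨y, rfl⟩ h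
    exact ⟨x ⊔ y, (hf.sum_iff.1 h).2⟩

theorem rangeSubalgebra_isBoolean (hf : IsBoolEmb f 1) : hf.rangeSubalgebra.IsBoolean := by
  let e : B ≃ hf.rangeSubalgebra.carrier := Equiv.ofInjective f hf.injective
  have he : ∀ a, f (e.symm a) = a.1 := fun a => Equiv.apply_ofInjective_symm hf.injective a
  refine isBooleanOrtho_of_equiv e.symm ?_ ?_ ?_ ?_
  · exact hf.injective ((he _).trans hf.map_bot.symm)
  · exact hf.injective ((he _).trans hf.map_top.symm)
  · intro a
    refine hf.injective ((he _).trans ?_)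
    rw [hf.map_compl, he]
    rfl
  · intro a b c
    change OSum a.1 b.1 c.1 ↔ _
    rw [← he a, ← he b, ← he c, hf.sum_iff, disjoint_iff, hf.injective.eq_iff]

/-- The image of a faithful embedding onto the whole orthoalgebra is a Boolean subalgebra. -/
def range (hf : IsBoolEmb f 1) : BSub A := ⟨hf.rangeSubalgebra, hf.rangeSubalgebra_isBoolean⟩

/-- The sum of two embeddings onto orthogonal intervals. -/
noncomputable def sum (f : B → A) (g : C → A) (x : B × C) : A :=
  -- The value `0` is never reached when `f` and `g` lie below orthogonal elements, by `sum_spec`.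
  open Classical in if h : ∃ c, OSum (f x.1) (g x.2) c then h.choose else 0

theorem sum_spec (hf : IsBoolEmb f s) (hg : IsBoolEmb g t) (h : OSum s t w) (x : B) (y : C) :
    OSum (f x) (g y) (sum f g (x, y)) := by
  obtain ⟨c, hc, -⟩ := sum_mono h (hf.le_top x) (hg.le_top y)
  have hc' : ∃ c, OSum (f x) (g y) c := ⟨c, hc⟩
  rw [sum, dif_pos hc']
  exact hc'.choose_spec

/-- Additivity is the interchange law for four summands. The four-element and eight-element
subalgebras and the gluing of two subalgebras all come from this. -/
theorem isBoolEmb_sum (hf : IsBoolEmb f s) (hg : IsBoolEmb g t) (h : OSum s t w) :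
    IsBoolEmb (sum f g) w where
  map_sum := by
    rintro ⟨x₁, y₁⟩ ⟨x₂, y₂⟩ hd
    rw [Prod.disjoint_iff] at hd
    obtain ⟨p, q, hp, hq, hpq⟩ := sum_sum_sum_comm (hf.map_sum _ _ hd.1) (hg.map_sum _ _ hd.2)
      (sum_spec hf hg h _ _)
    rw [uniq hp (sum_spec hf hg h _ _), uniq hq (sum_spec hf hg h _ _)] at hpq
    exact hpq
  map_top := by
    have := sum_spec hf hg h ⊤ ⊤
    rw [hf.map_top, hg.map_top] at this
    exact uniq this h
  eq_bot := by
    rintro ⟨x, y⟩ h0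
    have := sum_spec hf hg h x y
    rw [h0] at this
    exact Prod.ext (hf.eq_bot _ (le_zero (le_sum_left this)))
      (hg.eq_bot _ (le_zero (le_sum_right this)))

end IsBoolEmb

/-! ### The Boolean algebra carried by a Boolean subalgebra. -/

section Chosen

variable {A : Type u} [OrthoOps A] [IsOrthoalgebra A]

theorem isBoolEmb_bool {t : A} (ht : t ≠ 0) : IsBoolEmb (fun b : Bool => if b then t else 0) t where
  map_sum := by
    rintro (_ | _) (_ | _) h
    · exact ortho_sum_zero 0
    · exact zero_sum t
    · exact ortho_sum_zero t
    · simp at h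
  map_top := rfl
  eq_bot := by
    rintro (_ | _) h
    · rfl
    · exact absurd h ht

/-- Being Boolean only asserts existence, so a structure is chosen. The choice is harmless, since
its order is that of `A` by `BSub.le_iff`. -/
noncomputable instance _root_.BSub.booleanAlgebra (y : BSub A) : BooleanAlgebra y.carrier :=
  y.boolean.choose

variable {x y z : BSub A}

theorem _root_.BSub.coe_bot (y : BSub A) : ((⊥ : y.carrier) : A) = 0 :=
  (congrArg Subtype.val y.boolean.choose_spec.1).symm

theorem _root_.BSub.coe_top (y : BSub A) : ((⊤ : y.carrier) : A) = 1 :=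
  (congrArg Subtype.val y.boolean.choose_spec.2.1).symm

theorem _root_.BSub.coe_compl (a : y.carrier) : ((aᶜ : y.carrier) : A) = oc a.1 :=
  (congrArg Subtype.val (y.boolean.choose_spec.2.2.1 a)).symm

theorem _root_.BSub.sum_iff (a b c : y.carrier) : OSum a.1 b.1 c.1 ↔ Disjoint a b ∧ a ⊔ b = c := by
  rw [disjoint_iff]
  exact y.boolean.choose_spec.2.2.2 a b c

theorem _root_.BSub.isBoolEmb (y : BSub A) : IsBoolEmb (Subtype.val : y.carrier → A) 1 where
  map_sum a b h := (BSub.sum_iff a b _).2 ⟨h, rfl⟩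
  map_top := BSub.coe_top y
  eq_bot _ h := Subtype.ext (h.trans (BSub.coe_bot y).symm)

/-- Differences are obtained from sums and complements, because `b' = a ⊕ c'`. -/
theorem _root_.BSub.mem_of_sum {a b c : A} (ha : a ∈ y.carrier) (hc : c ∈ y.carrier) (h : OSum a b c) :
    b ∈ y.carrier := by
  obtain ⟨d, hd⟩ := orth_iff.2 (oc_le_oc (le_sum_left h))
  have h1 := y.sum_mem _ _ _ ha (y.oc_mem _ hc) hd
  rw [uniq hd (rotate (comm h))] at h1
  simpa using y.oc_mem _ h1

theorem _root_.BSub.le_iff {a b : y.carrier} : a ≤ b ↔ OrthoLE a.1 b.1 := by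
  refine ⟨fun h => y.isBoolEmb.mono h, ?_⟩
  rintro ⟨c, hc⟩
  have hc' := BSub.mem_of_sum a.2 b.2 hc
  rw [← ((BSub.sum_iff a ⟨c, hc'⟩ b).1 hc).2]
  exact le_sup_left

theorem _root_.BSub.oc_mem_iff {a : A} : oc a ∈ y.carrier ↔ a ∈ y.carrier :=
  ⟨fun h => by simpa using y.oc_mem _ h, y.oc_mem a⟩

theorem _root_.BSub.exists_mackey (a b : y.carrier) : ∃ p q s : y.carrier,
    OSum (a ⊓ b).1 p.1 a.1 ∧ OSum (a ⊓ b).1 q.1 b.1 ∧ OSum p.1 q.1 s.1 := by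
  refine ⟨a \ b, b \ a, _, ?_, ?_, y.isBoolEmb.map_sum _ _ disjoint_sdiff_sdiff⟩
  · exact (BSub.sum_iff _ _ _).2
      ⟨disjoint_sdiff_self_right.mono_left inf_le_right, sup_inf_sdiff a b⟩
  · exact (BSub.sum_iff _ _ _).2 ⟨disjoint_sdiff_self_right.mono_left inf_le_left, by
      rw [inf_comm]; exact sup_inf_sdiff b a⟩

/-- The Mackey decomposition over the meet in `x` persists in `y`. There its remainders are still
disjoint, and distributivity returns the same meet. -/
theorem _root_.BSub.coe_inf (h : x ≤ y) (a b : x.carrier) :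
    ((a ⊓ b : x.carrier) : A) = ((⟨a, h a.2⟩ ⊓ ⟨b, h b.2⟩ : y.carrier) : A) := by
  obtain ⟨p, q, s, hp, hq, hs⟩ := BSub.exists_mackey a b
  have hp' := (BSub.sum_iff (y := y) ⟨_, h (a ⊓ b).2⟩ ⟨_, h p.2⟩ ⟨_, h a.2⟩).1 hp
  have hq' := (BSub.sum_iff (y := y) ⟨_, h (a ⊓ b).2⟩ ⟨_, h q.2⟩ ⟨_, h b.2⟩).1 hq
  have hs' := (BSub.sum_iff (y := y) ⟨_, h p.2⟩ ⟨_, h q.2⟩ ⟨_, h s.2⟩).1 hs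
  rw [← hp'.2, ← hq'.2, ← sup_inf_left, hs'.1.eq_bot, sup_bot_eq]

theorem _root_.BSub.inf_mem (h : x ≤ y) {a b : y.carrier} (ha : a.1 ∈ x.carrier) (hb : b.1 ∈ x.carrier) :
    (a ⊓ b).1 ∈ x.carrier := by
  have := BSub.coe_inf h ⟨a, ha⟩ ⟨b, hb⟩
  exact this ▸ Subtype.coe_prop _

/-- The trace of `S` on `y`, for `S ≤ y`, as a subalgebra of the Boolean algebra `y`. -/
noncomputable def _root_.BSub.toBooleanSubalgebra (y : BSub A) (S : Set.Iic y) : BooleanSubalgebra y.carrier where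
  carrier := {a | a.1 ∈ S.1.carrier}
  bot_mem' := by
    change _ ∈ S.1.carrier
    rw [BSub.coe_bot]
    exact S.1.zero_mem
  compl_mem' {a} h := by
    change _ ∈ S.1.carrier
    rw [BSub.coe_compl]
    exact S.1.oc_mem _ h
  infClosed' a ha b hb := BSub.inf_mem S.2 ha hb
  supClosed' a ha b hb := by
    change _ ∈ S.1.carrier
    have e : a ⊔ b = (aᶜ ⊓ bᶜ)ᶜ := by simp
    rw [e, BSub.coe_compl]
    refine S.1.oc_mem _ (BSub.inf_mem S.2 ?_ ?_)
    · rw [BSub.coe_compl]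
      exact S.1.oc_mem _ ha
    · rw [BSub.coe_compl]
      exact S.1.oc_mem _ hb

theorem _root_.BSub.isBoolEmb_subtype (y : BSub A) (L : BooleanSubalgebra y.carrier) :
    IsBoolEmb (fun a : L => (a : y.carrier).1) 1 where
  map_sum a b h := y.isBoolEmb.map_sum a.1 b.1 (by
    rw [disjoint_iff] at h ⊢
    exact congrArg Subtype.val h)
  map_top := BSub.coe_top y
  eq_bot a h := Subtype.ext (y.isBoolEmb.eq_bot _ h)

/-- The Boolean subalgebras below `y` are the subalgebras of the Boolean algebra `y`. -/
noncomputable def _root_.BSub.iicIso (y : BSub A) : Set.Iic y ≃o BooleanSubalgebra y.carrier where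
  toFun := BSub.toBooleanSubalgebra y
  invFun L := ⟨(BSub.isBoolEmb_subtype y L).range, by
    rintro _ ⟨a, rfl⟩
    exact a.1.2⟩
  left_inv S := by
    refine Subtype.ext (BSub.ext (Set.ext fun a => ⟨?_, fun h => ?_⟩))
    · rintro ⟨b, rfl⟩
      exact b.2
    · exact ⟨⟨⟨a, S.2 h⟩, h⟩, rfl⟩
  right_inv L := by
    refine BooleanSubalgebra.ext fun a => ⟨?_, fun h => ⟨⟨a, h⟩, rfl⟩⟩
    rintro ⟨b, hb⟩
    rw [← Subtype.ext hb]
    exact b.2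
  map_rel_iff' {S T} := by
    refine ⟨fun h a ha => ?_, fun h a ha => h ha⟩
    exact h (show (⟨a, S.2 ha⟩ : y.carrier) ∈ BSub.toBooleanSubalgebra y S from ha)

theorem _root_.BSub.mem_iicIso {S : Set.Iic y} {a : y.carrier} : a ∈ BSub.iicIso y S ↔ a.1 ∈ S.1.carrier :=
  Iff.rfl

theorem _root_.BSub.mem_iicIso_symm {L : BooleanSubalgebra y.carrier} {a : A} :
    a ∈ ((BSub.iicIso y).symm L).1.carrier ↔ ∃ h : a ∈ y.carrier, ⟨a, h⟩ ∈ L := by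
  constructor
  · rintro ⟨b, rfl⟩
    exact ⟨b.1.2, b.2⟩
  · rintro ⟨h, h'⟩
    exact ⟨⟨_, h'⟩, rfl⟩

theorem subalgebra_isOrthoalgebra (S : OrthoSubalgebra A) : IsOrthoalgebra S.carrier where
  sum_unique a b c d h h' := Subtype.ext (sum_unique a.1 b.1 c.1 d.1 h h')
  sum_comm a b c h := sum_comm a.1 b.1 c.1 h
  sum_assoc a b c s := by
    constructor
    · rintro ⟨p, hp, hs⟩
      obtain ⟨q, hq, hq'⟩ := assoc_right (A := A) hp hs
      exact ⟨⟨q, S.sum_mem _ _ _ b.2 c.2 hq⟩, hq, hq'⟩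
    · rintro ⟨q, hq, hs⟩
      obtain ⟨p, hp, hp'⟩ := assoc_left (A := A) hq hs
      exact ⟨⟨p, S.sum_mem _ _ _ a.2 b.2 hp⟩, hp, hp'⟩
  sum_eq_one_iff a b :=
    (sum_eq_one_iff a.1 b.1).trans (Subtype.ext_iff (a1 := b) (a2 := oc a)).symm
  sum_self_iff a := by
    refine ⟨fun ⟨c, h⟩ => Subtype.ext (eq_zero_of_sum_self (A := A) h), ?_⟩
    rintro rfl
    exact ⟨0, ortho_sum_zero (0 : A)⟩

/-- A subalgebra that is a directed union of Boolean subalgebras is Boolean. -/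
theorem isBoolean_of_directed {S : OrthoSubalgebra A} {D : Set (BSub A)}
    (hD : DirectedOn (· ≤ ·) D) (hS : S.carrier = ⋃ y ∈ D, y.carrier) : S.IsBoolean := by
  have ex : ∀ a ∈ S.carrier, ∃ y ∈ D, a ∈ y.carrier := by
    intro a ha
    rw [hS] at ha
    simpa using ha
  have sub : ∀ y ∈ D, y.carrier ⊆ S.carrier := by
    intro y hy a ha
    rw [hS]
    simp only [Set.mem_iUnion]
    exact ⟨y, hy, ha⟩
  have := subalgebra_isOrthoalgebra S
  refine isBooleanOrtho_of_mackey fun a b => ?_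
  obtain ⟨y₁, h₁, ha⟩ := ex a.1 a.2
  obtain ⟨y₂, h₂, hb⟩ := ex b.1 b.2
  obtain ⟨y, hy, hy₁, hy₂⟩ := hD y₁ h₁ y₂ h₂
  let a' : y.carrier := ⟨a.1, hy₁ ha⟩
  let b' : y.carrier := ⟨b.1, hy₂ hb⟩
  obtain ⟨p, q, s, hp, hq, hs⟩ := BSub.exists_mackey a' b'
  refine ⟨⟨_, sub y hy (a' ⊓ b').2⟩, ⟨_, sub y hy p.2⟩, ⟨_, sub y hy q.2⟩, ⟨_, sub y hy s.2⟩,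
    hp, hq, hs, ?_⟩
  -- A lower bound `c` need not lie in `y`. It is compared with the meet in a larger member `z` of
  -- `D`, where that meet is unchanged.
  rintro c ⟨d, hca⟩ ⟨e, hcb⟩
  obtain ⟨y₃, h₃, hc⟩ := ex c.1 c.2
  obtain ⟨z, hz, hyz, hz₃⟩ := hD y hy y₃ h₃
  have hinf := BSub.coe_inf hyz a' b'
  have hle : (⟨c.1, hz₃ hc⟩ : z.carrier) ≤ ⟨a', hyz a'.2⟩ ⊓ ⟨b', hyz b'.2⟩ :=
    le_inf (BSub.le_iff.2 ⟨d.1, hca⟩) (BSub.le_iff.2 ⟨e.1, hcb⟩)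
  obtain ⟨r, hr⟩ := BSub.le_iff.1 hle
  rw [← hinf] at hr
  exact ⟨⟨r, sub z hz (BSub.mem_of_sum (hz₃ hc) (hyz (a' ⊓ b').2) hr)⟩, hr⟩

end Chosen

/-! ### Dual modularity and principal pairs under order isomorphisms. -/

section DualModular

/-- The reverse inequalities hold in every lattice. -/
theorem isDualModular_iff {L : Type*} [Lattice L] {x : L} :
    IsDualModular x ↔ (∀ y z, x ≤ z → (x ⊔ y) ⊓ z ≤ x ⊔ (y ⊓ z)) ∧
      (∀ w y, w ≤ y → (w ⊔ x) ⊓ y ≤ w ⊔ (x ⊓ y)) := by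
  constructor
  · rintro ⟨h₁, h₂⟩
    exact ⟨fun y z h => (h₁ y z h _ _ _ _ isLUB_pair isGLB_pair isGLB_pair isLUB_pair).le,
      fun w y h => (h₂ w y h _ _ _ _ isLUB_pair isGLB_pair isGLB_pair isLUB_pair).le⟩
  · rintro ⟨h₁, h₂⟩
    constructor
    · intro y z h s l m r hs hl hm hr
      obtain rfl := hs.unique isLUB_pair
      obtain rfl := hl.unique isGLB_pair
      obtain rfl := hm.unique isGLB_pair
      obtain rfl := hr.unique isLUB_pair
      exact le_antisymm (h₁ y z h) (le_inf (sup_le_sup_left inf_le_left _)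
        (sup_le h inf_le_right))
    · intro w y h s l m r hs hl hm hr
      obtain rfl := hs.unique isLUB_pair
      obtain rfl := hl.unique isGLB_pair
      obtain rfl := hm.unique isGLB_pair
      obtain rfl := hr.unique isLUB_pair
      exact le_antisymm (h₂ w y h) (le_inf (sup_le_sup_left inf_le_left _)
        (sup_le h inf_le_right))

variable {X Y : Type*} [PartialOrder X] [PartialOrder Y]

theorem isLUB_pair_map (e : X ≃o Y) {x y z : X} :
    IsLUB {e x, e y} (e z) ↔ IsLUB {x, y} z := by
  rw [← Set.image_pair, e.isLUB_image']

theorem isGLB_pair_map (e : X ≃o Y) {x y z : X} :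
    IsGLB {e x, e y} (e z) ↔ IsGLB {x, y} z := by
  rw [← Set.image_pair, e.isGLB_image']

theorem isDualModular_map (e : X ≃o Y) {x : X} : IsDualModular (e x) ↔ IsDualModular x := by
  have key : ∀ {X Y : Type _} [PartialOrder X] [PartialOrder Y] (e : X ≃o Y) (x : X),
      IsDualModular (e x) → IsDualModular x := by
    intro X Y _ _ e x h
    refine ⟨fun y z hz s l m r hs hl hm hr => e.injective ?_,
      fun y z hz s l m r hs hl hm hr => e.injective ?_⟩
    · exact h.1 _ _ (e.monotone hz) _ _ _ _ ((isLUB_pair_map e).2 hs) ((isGLB_pair_map e).2 hl)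
        ((isGLB_pair_map e).2 hm) ((isLUB_pair_map e).2 hr)
    · exact h.2 _ _ (e.monotone hz) _ _ _ _ ((isLUB_pair_map e).2 hs) ((isGLB_pair_map e).2 hl)
        ((isGLB_pair_map e).2 hm) ((isLUB_pair_map e).2 hr)
  refine ⟨key e x, fun h => ?_⟩
  constructor
  · intro y z hz s l m r hs hl hm hr
    obtain ⟨y, rfl⟩ := e.surjective y
    obtain ⟨z, rfl⟩ := e.surjective z
    obtain ⟨s, rfl⟩ := e.surjective s
    obtain ⟨l, rfl⟩ := e.surjective l
    obtain ⟨m, rfl⟩ := e.surjective m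
    obtain ⟨r, rfl⟩ := e.surjective r
    rw [isLUB_pair_map] at hs hr
    rw [isGLB_pair_map] at hl hm
    rw [h.1 y z (e.le_iff_le.1 hz) s l m r hs hl hm hr]
  · intro y z hz s l m r hs hl hm hr
    obtain ⟨y, rfl⟩ := e.surjective y
    obtain ⟨z, rfl⟩ := e.surjective z
    obtain ⟨s, rfl⟩ := e.surjective s
    obtain ⟨l, rfl⟩ := e.surjective l
    obtain ⟨m, rfl⟩ := e.surjective m
    obtain ⟨r, rfl⟩ := e.surjective r
    rw [isLUB_pair_map] at hs hr
    rw [isGLB_pair_map] at hl hm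
    rw [h.2 y z (e.le_iff_le.1 hz) s l m r hs hl hm hr]

variable [OrderBot X] [OrderBot Y] [OrderTop X] [OrderTop Y]

theorem isBasic_map (e : X ≃o Y) {x : X} : IsBasic (e x) ↔ IsBasic x := by
  rw [IsBasic, IsBasic, e.isAtom_iff, map_eq_bot_iff]

theorem isPrincipalPairFor_map (e : X ≃o Y) {x y z : X} :
    IsPrincipalPairFor (e x) (e y) (e z) ↔ IsPrincipalPairFor x y z := by
  rw [IsPrincipalPairFor, IsPrincipalPairFor, IsPrincipalPair, IsPrincipalPair, isGLB_pair_map,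
    isDualModular_map, isDualModular_map, isBasic_map, isBasic_map, map_eq_top_iff, map_eq_top_iff,
    ← e.map_top, isLUB_pair_map, e.surjective.exists]
  simp only [isGLB_pair_map, isBasic_map, isDualModular_map]

end DualModular

/-! ### Principal pairs in the subalgebra lattice of a Boolean algebra. -/

section Principal

variable {B : Type*} [BooleanAlgebra B] {a b c p r s : B} {Y Z : BooleanSubalgebra B}

/-- The Boolean subalgebra made of the principal ideal of `a` and the complementary filter. -/
def principal (a : B) : BooleanSubalgebra B where
  carrier := {b | b ≤ a ∨ aᶜ ≤ b}
  bot_mem' := Or.inl bot_le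
  compl_mem' := by
    rintro b (h | h)
    · exact Or.inr (compl_le_compl h)
    · exact Or.inl (compl_le_iff_compl_le.1 h)
  supClosed' := by
    rintro b (h | h) c (h' | h')
    · exact Or.inl (sup_le h h')
    · exact Or.inr (h'.trans le_sup_right)
    · exact Or.inr (h.trans le_sup_left)
    · exact Or.inr (h.trans le_sup_left)
  infClosed' := by
    rintro b (h | h) c (h' | h')
    · exact Or.inl (inf_le_left.trans h)
    · exact Or.inl (inf_le_left.trans h)
    · exact Or.inl (inf_le_right.trans h')
    · exact Or.inr (le_inf h h')

theorem mem_principal : b ∈ principal a ↔ b ≤ a ∨ aᶜ ≤ b := Iff.rfl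

/-- The Boolean subalgebra generated by `a`. -/
def gen (a : B) : BooleanSubalgebra B where
  carrier := {b | b = ⊥ ∨ b = a ∨ b = aᶜ ∨ b = ⊤}
  bot_mem' := by simp
  compl_mem' := by
    rintro b (rfl | rfl | rfl | rfl) <;> simp
  supClosed' := by
    rintro b (rfl | rfl | rfl | rfl) c (rfl | rfl | rfl | rfl) <;> simp
  infClosed' := by
    rintro b (rfl | rfl | rfl | rfl) c (rfl | rfl | rfl | rfl) <;> simp

theorem mem_gen : b ∈ gen a ↔ b = ⊥ ∨ b = a ∨ b = aᶜ ∨ b = ⊤ := Iff.rfl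

theorem self_mem_gen (a : B) : a ∈ gen a := Or.inr (Or.inl rfl)

theorem gen_le : gen a ≤ Y ↔ a ∈ Y := by
  refine ⟨fun h => h (self_mem_gen a), fun h => ?_⟩
  rintro b (rfl | rfl | rfl | rfl)
  · exact BooleanSubalgebra.bot_mem
  · exact h
  · exact BooleanSubalgebra.compl_mem h
  · exact BooleanSubalgebra.top_mem

theorem gen_compl : gen aᶜ = gen a :=
  le_antisymm (gen_le.2 (BooleanSubalgebra.compl_mem (self_mem_gen a)))
    (gen_le.2 (BooleanSubalgebra.compl_mem_iff.1 (self_mem_gen aᶜ)))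

theorem eq_of_mem_gen_of_le (h : b ∈ gen a) (hb : b ≤ a) : b = ⊥ ∨ b = a := by
  rcases h with rfl | rfl | rfl | rfl
  · exact Or.inl rfl
  · exact Or.inr rfl
  · refine Or.inl ?_
    have := le_compl_self.1 (le_compl_iff_le_compl.1 (compl_le_compl hb))
    exact this
  · exact Or.inr (top_le_iff.1 hb).symm

/-- The join of `principal a` and `Y`. -/
def principalSup (a : B) (Y : BooleanSubalgebra B) : BooleanSubalgebra B where
  carrier := {c | ∃ y ∈ Y, c \ a = y \ a}
  bot_mem' := ⟨⊥, BooleanSubalgebra.bot_mem, rfl⟩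
  compl_mem' := by
    rintro c ⟨y, hy, h⟩
    refine ⟨yᶜ, BooleanSubalgebra.compl_mem hy, ?_⟩
    rw [sdiff_eq, sdiff_eq, ← compl_sup, ← compl_sup, ← sdiff_sup_self, h, sdiff_sup_self]
  supClosed' := by
    rintro c ⟨y, hy, h⟩ d ⟨z, hz, h'⟩
    exact ⟨y ⊔ z, BooleanSubalgebra.sup_mem hy hz, by rw [sup_sdiff, sup_sdiff, h, h']⟩
  infClosed' := by
    rintro c ⟨y, hy, h⟩ d ⟨z, hz, h'⟩
    exact ⟨y ⊓ z, BooleanSubalgebra.inf_mem hy hz, by rw [inf_sdiff, inf_sdiff, h, h']⟩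

theorem principal_sup_le : principal a ⊔ Y ≤ principalSup a Y := by
  refine sup_le ?_ fun y hy => ⟨y, hy, rfl⟩
  rintro b (h | h)
  · exact ⟨⊥, BooleanSubalgebra.bot_mem, by rw [sdiff_eq_bot_iff.2 h, bot_sdiff]⟩
  · refine ⟨⊤, BooleanSubalgebra.top_mem, ?_⟩
    rw [sdiff_eq, sdiff_eq, inf_eq_right.2 h, top_inf_eq]

/-- An element `c` of the join with another subalgebra agrees off `a` with some element `y` of the
latter. In the first law, `y` is rebuilt inside `Z` from `y ⊓ a` and `c \ a`, then `c` from `c ⊓ a`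
and `y \ a`. In the second, `c` differs from `w ∈ W` by `w \ c` and `c \ w`, which lie in `Y` and
below `a`. -/
theorem isDualModular_principal (a : B) : IsDualModular (principal a) := by
  rw [isDualModular_iff]
  have hac : aᶜ ∈ principal a := Or.inr le_rfl
  have below : ∀ b, b ⊓ a ∈ principal a := fun b => Or.inl inf_le_right
  constructor
  · rintro Y Z hZ c ⟨hc, hcZ⟩
    obtain ⟨y, hy, h⟩ := principal_sup_le hc
    have e1 : y = (y ⊓ a) ⊔ (c ⊓ aᶜ) := by
      rw [← sdiff_eq, h]
      exact (sup_inf_sdiff y a).symm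
    have hyZ : y ∈ Z := by
      rw [e1]
      exact BooleanSubalgebra.sup_mem (hZ (below y)) (BooleanSubalgebra.inf_mem hcZ (hZ hac))
    have e2 : c = (c ⊓ a) ⊔ (y ⊓ aᶜ) := by
      rw [← sdiff_eq, ← h]
      exact (sup_inf_sdiff c a).symm
    rw [e2]
    have h1 : principal a ≤ principal a ⊔ Y ⊓ Z := le_sup_left
    have h2 : Y ⊓ Z ≤ principal a ⊔ Y ⊓ Z := le_sup_right
    exact BooleanSubalgebra.sup_mem (h1 (below c))
      (BooleanSubalgebra.inf_mem (h2 ⟨hy, hyZ⟩) (h1 hac))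
  · rintro W Y hW c ⟨hc, hcY⟩
    rw [sup_comm] at hc
    obtain ⟨w, hw, h⟩ := principal_sup_le hc
    have le_of : ∀ u v : B, u \ a = v \ a → u \ v ≤ a := by
      intro u v huv
      rw [sdiff_le_iff, ← sdiff_le_iff', huv]
      exact sdiff_le
    have h1 : W ≤ W ⊔ principal a ⊓ Y := le_sup_left
    have h2 : principal a ⊓ Y ≤ W ⊔ principal a ⊓ Y := le_sup_right
    have e : c = (w \ (w \ c)) ⊔ (c \ w) := by
      rw [sdiff_sdiff_right_self, inf_comm]
      exact (sup_inf_sdiff c w).symm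
    rw [e]
    refine BooleanSubalgebra.sup_mem (BooleanSubalgebra.sdiff_mem (h1 hw) (h2 ⟨?_, ?_⟩))
      (h2 ⟨?_, ?_⟩)
    · exact Or.inl (le_of _ _ h.symm)
    · exact BooleanSubalgebra.sdiff_mem (hW hw) hcY
    · exact Or.inl (le_of _ _ h)
    · exact BooleanSubalgebra.sdiff_mem hcY (hW hw)

/-- The elements whose trace below `pᶜ` lies in `Y`. -/
def traceMem (Y : BooleanSubalgebra B) (hp : p ∈ Y) : BooleanSubalgebra B where
  carrier := {c | c \ p ∈ Y}
  bot_mem' := by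
    change _ \ _ ∈ Y
    rw [bot_sdiff]
    exact BooleanSubalgebra.bot_mem
  compl_mem' {c} h := by
    change _ \ _ ∈ Y
    rw [sdiff_eq, ← compl_sup, ← sdiff_sup_self]
    exact BooleanSubalgebra.compl_mem (BooleanSubalgebra.sup_mem h hp)
  supClosed' c hc d hd := by
    change _ \ _ ∈ Y
    rw [sup_sdiff]
    exact BooleanSubalgebra.sup_mem hc hd
  infClosed' c hc d hd := by
    change _ \ _ ∈ Y
    rw [inf_sdiff]
    exact BooleanSubalgebra.inf_mem hc hd

theorem mem_traceMem {hp : p ∈ Y} : c ∈ traceMem Y hp ↔ c \ p ∈ Y := Iff.rfl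

/-- Suppose `r ≤ p` and `s ≤ pᶜ` both miss `Y`. Test the first law on `gen (r ⊔ s)` and `traceMem Y
hp`: these meet trivially because `s ∉ Y`, yet `r = (r ⊔ s) ⊓ p` lies on the left side, which would
force `r ∈ Y`. -/
theorem below_subset_of_isDualModular (hY : IsDualModular Y) (hp : p ∈ Y) :
    (∀ r ≤ p, r ∈ Y) ∨ (∀ s ≤ pᶜ, s ∈ Y) := by
  by_contra! hcon
  obtain ⟨⟨r, hrp, hr⟩, s, hsp, hs⟩ := hcon
  have hZ : Y ≤ traceMem Y hp := fun c hc => BooleanSubalgebra.sdiff_mem hc hp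
  have hsd : Disjoint s p := disjoint_compl_left.mono_left hsp
  have e1 : (r ⊔ s) ⊓ p = r := by
    rw [inf_sup_right, inf_eq_left.2 hrp, hsd.eq_bot, sup_bot_eq]
  have e2 : (r ⊔ s) \ p = s := by
    rw [sup_sdiff, sdiff_eq_bot_iff.2 hrp, bot_sup_eq, hsd.sdiff_eq_left]
  have hb : r ⊔ s ∉ traceMem Y hp := by
    rw [mem_traceMem, e2]
    exact hs
  have hF : gen (r ⊔ s) ⊓ traceMem Y hp ≤ ⊥ := by
    rintro c ⟨rfl | rfl | rfl | rfl, hc⟩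
    · exact BooleanSubalgebra.bot_mem
    · exact absurd hc hb
    · exact absurd (BooleanSubalgebra.compl_mem_iff.1 hc) hb
    · exact BooleanSubalgebra.top_mem
  have h1 : r ∈ (Y ⊔ gen (r ⊔ s)) ⊓ traceMem Y hp := by
    constructor
    · have hY' : Y ≤ Y ⊔ gen (r ⊔ s) := le_sup_left
      have hG : gen (r ⊔ s) ≤ Y ⊔ gen (r ⊔ s) := le_sup_right
      have := BooleanSubalgebra.inf_mem (hG (self_mem_gen _)) (hY' hp)
      rwa [e1] at this
    · change r \ p ∈ Y
      rw [sdiff_eq_bot_iff.2 hrp]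
      exact BooleanSubalgebra.bot_mem
  have h2 := (isDualModular_iff.1 hY).1 _ _ hZ h1
  rw [le_bot_iff.1 hF, sup_bot_eq] at h2
  exact hr h2

theorem principal_inf_principal_compl : principal a ⊓ principal aᶜ = gen a := by
  refine BooleanSubalgebra.ext fun b => ?_
  rw [BooleanSubalgebra.mem_inf, mem_principal, mem_principal, mem_gen, compl_compl]
  constructor
  · rintro ⟨h | h, h' | h'⟩
    · exact Or.inl (le_bot_iff.1 (inf_compl_self a ▸ le_inf h h'))
    · exact Or.inr (Or.inl (le_antisymm h h'))
    · exact Or.inr (Or.inr (Or.inl (le_antisymm h' h)))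
    · exact Or.inr (Or.inr (Or.inr (top_le_iff.1 (sup_compl_eq_top (x := a) ▸ sup_le h' h))))
  · rintro (rfl | rfl | rfl | rfl) <;> simp

theorem principal_sup_principal_compl : principal a ⊔ principal aᶜ = ⊤ := by
  refine top_le_iff.1 fun c _ => ?_
  have h1 : principal a ≤ principal a ⊔ principal aᶜ := le_sup_left
  have h2 : principal aᶜ ≤ principal a ⊔ principal aᶜ := le_sup_right
  rw [← sup_inf_sdiff c a, sdiff_eq]
  exact BooleanSubalgebra.sup_mem (h1 (Or.inl inf_le_right)) (h2 (Or.inl inf_le_right))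

theorem gen_le_principal : gen a ≤ principal a := gen_le.2 (Or.inl le_rfl)

theorem principal_le (h : ∀ r ≤ a, r ∈ Y) : principal a ≤ Y := by
  rintro b (hb | hb)
  · exact h b hb
  · exact BooleanSubalgebra.compl_mem_iff.1 (h _ (compl_le_iff_compl_le.1 hb))

theorem principal_eq_of_below (h : ∀ r ≤ a, r ∈ gen a) :
    principal a = gen a ∧ principal aᶜ = ⊤ := by
  have h1 : principal a = gen a := le_antisymm (principal_le h) gen_le_principal
  refine ⟨h1, ?_⟩
  have h2 := principal_sup_principal_compl (a := a)
  rwa [h1, sup_eq_right.2 (gen_compl (a := a) ▸ gen_le_principal)] at h2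

theorem isBasic_gen (a : B) : IsBasic (gen a) := by
  by_cases h : gen a = ⊥
  · exact Or.inl h
  refine Or.inr ⟨h, fun Y hY => le_bot_iff.1 fun b hb => ?_⟩
  have hna : a ∉ Y := fun hn => hY.not_ge (gen_le.2 hn)
  rcases hY.le hb with rfl | rfl | rfl | rfl
  · exact BooleanSubalgebra.bot_mem
  · exact absurd hb hna
  · exact absurd (BooleanSubalgebra.compl_mem_iff.1 hb) hna
  · exact BooleanSubalgebra.top_mem

/-- Here `a` or `aᶜ` has nothing below it outside `gen a`. This is the degenerate case, which
accounts for the clauses with `⊤` in the definition of principal pairs. -/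
theorem principal_of_isDualModular_gen (h : IsDualModular (gen a)) :
    (principal a = gen a ∧ principal aᶜ = ⊤) ∨ (principal a = ⊤ ∧ principal aᶜ = gen a) := by
  rcases below_subset_of_isDualModular h (self_mem_gen a) with h | h
  · exact Or.inl (principal_eq_of_below h)
  · rw [← gen_compl] at h
    obtain ⟨h1, h2⟩ := principal_eq_of_below h
    rw [compl_compl] at h2
    exact Or.inr ⟨h2, h1.trans gen_compl⟩

theorem isPrincipalPairFor_principal (a : B) :
    IsPrincipalPairFor (gen a) (principal a) (principal aᶜ) := by
  have hglb : IsGLB {principal a, principal aᶜ} (gen a) := by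
    rw [← principal_inf_principal_compl]
    exact isGLB_pair
  refine ⟨⟨isDualModular_principal a, isDualModular_principal aᶜ, ?_⟩, hglb⟩
  by_cases h : IsDualModular (gen a)
  · rcases principal_of_isDualModular_gen h with ⟨h1, h2⟩ | ⟨h1, h2⟩
    · exact Or.inr (Or.inl ⟨h2, h1 ▸ isBasic_gen a⟩)
    · exact Or.inl ⟨h1, h2 ▸ isBasic_gen a⟩
  · refine Or.inr (Or.inr ⟨?_, gen a, hglb, isBasic_gen a, h⟩)
    rw [← principal_sup_principal_compl (a := a)]
    exact isLUB_pair

/-- For `p ∈ Y`, the part `p \ a` lies in `Y` and in `Z`, hence in `gen a`; being below `aᶜ`, it is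
`⊥` or `aᶜ`. -/
theorem le_principal_of_inf_eq (hYZ : Y ⊓ Z = gen a) (hZ : ∀ r ≤ aᶜ, r ∈ Z) : Y ≤ principal a := by
  intro p hp
  have ha : a ∈ Y := (hYZ ▸ self_mem_gen a : a ∈ Y ⊓ Z).1
  have hq : p \ a ∈ gen aᶜ := by
    rw [gen_compl, ← hYZ]
    exact ⟨BooleanSubalgebra.sdiff_mem hp ha, hZ _ (by rw [sdiff_eq]; exact inf_le_right)⟩
  rcases eq_of_mem_gen_of_le hq (by rw [sdiff_eq]; exact inf_le_right) with h | h
  · exact Or.inl (sdiff_eq_bot_iff.1 h)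
  · exact Or.inr (h ▸ sdiff_le)

/-- If one member is `⊤`, the other is `gen a`, which is then dual modular. Otherwise each of `Y`,
`Z` contains all elements below `a` or all below `aᶜ`. They cannot contain the same ideal, since
then `gen a` would be dual modular; and once they contain opposite ideals, `Y ⊓ Z = gen a` leaves no
room for more. -/
theorem isPrincipalPairFor_gen_iff :
    IsPrincipalPairFor (gen a) Y Z ↔
      (Y = principal a ∧ Z = principal aᶜ) ∨ (Y = principal aᶜ ∧ Z = principal a) := by
  constructor
  swap
  · rintro (⟨rfl, rfl⟩ | ⟨rfl, rfl⟩)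
    · exact isPrincipalPairFor_principal a
    · exact (isPrincipalPairFor_principal a).swap
  rintro ⟨⟨hY, hZ, h⟩, hglb⟩
  have hinf : Y ⊓ Z = gen a := isGLB_pair.unique hglb
  have top_case : ∀ {U V : BooleanSubalgebra B}, IsDualModular V → U ⊓ V = gen a → U = ⊤ →
      (U = principal a ∧ V = principal aᶜ) ∨ (U = principal aᶜ ∧ V = principal a) := by
    rintro U V hV hUV rfl
    rw [top_inf_eq] at hUV
    rw [hUV] at hV ⊢
    rcases principal_of_isDualModular_gen hV with ⟨h1, h2⟩ | ⟨h1, h2⟩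
    · exact Or.inr ⟨h2.symm, h1.symm⟩
    · exact Or.inl ⟨h1.symm, h2.symm⟩
  rcases h with ⟨h, -⟩ | ⟨h, -⟩ | ⟨-, m, hm, -, hnot⟩
  · exact top_case hZ hinf h
  · rw [inf_comm] at hinf
    rcases top_case hY hinf h with h | h
    · exact Or.inr h.symm
    · exact Or.inl h.symm
  obtain rfl := hm.unique hglb
  have hmem : a ∈ Y ⊓ Z := hinf ▸ self_mem_gen a
  -- Stated for any generator `b` of `gen a`, in order to serve for both `a` and `aᶜ`.
  have not_both : ∀ b, gen b = gen a → (∀ r ≤ b, r ∈ Y) → (∀ r ≤ b, r ∈ Z) → False := by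
    intro b hb h1 h2
    apply hnot
    rw [← hb]
    have := (principal_eq_of_below (a := b) fun r hr => by
      rw [hb, ← hinf]
      exact ⟨h1 r hr, h2 r hr⟩).1
    exact this ▸ isDualModular_principal b
  rcases below_subset_of_isDualModular hY hmem.1 with hY' | hY' <;>
    rcases below_subset_of_isDualModular hZ hmem.2 with hZ' | hZ'
  · exact (not_both a rfl hY' hZ').elim
  · refine Or.inl ⟨le_antisymm (le_principal_of_inf_eq hinf hZ') (principal_le hY'),
      le_antisymm (le_principal_of_inf_eq (Z := Y) ?_ ?_)
        (principal_le hZ')⟩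
    · rw [inf_comm, hinf, gen_compl]
    · rwa [compl_compl]
  · refine Or.inr ⟨le_antisymm (le_principal_of_inf_eq (Z := Z) ?_ ?_)
        (principal_le hY'),
      le_antisymm (le_principal_of_inf_eq (by rw [inf_comm, hinf]) hY')
        (principal_le hZ')⟩
    · rw [hinf, gen_compl]
    · rwa [compl_compl]
  · exact (not_both aᶜ gen_compl hY' hZ').elim

end Principal

/-! ### Compactness and Boolean domains under order isomorphisms. -/

section Transfer

variable {X Y : Type*} [PartialOrder X] [PartialOrder Y]

/-- An order isomorphism restricts to principal ideals. -/
def iicCongr (e : X ≃o Y) (x : X) : Set.Iic x ≃o Set.Iic (e x) where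
  toFun a := ⟨e a.1, e.monotone a.2⟩
  invFun b := ⟨e.symm b.1, e.symm_apply_le.2 b.2⟩
  left_inv a := Subtype.ext (e.symm_apply_apply a.1)
  right_inv b := Subtype.ext (e.apply_symm_apply b.1)
  map_rel_iff' := e.le_iff_le

theorem isCompactIn_map (e : X ≃o Y) {x : X} (h : IsCompactIn x) : IsCompactIn (e x) := by
  intro D hD hdir s hs hxs
  have hs' : IsLUB (e ⁻¹' D) (e.symm s) := by rwa [e.isLUB_preimage, e.apply_symm_apply]
  obtain ⟨y, hy, hxy⟩ := h (e ⁻¹' D) (hD.preimage e.surjective) (fun a ha b hb => by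
    obtain ⟨c, hc, hac, hbc⟩ := hdir _ ha _ hb
    exact ⟨e.symm c, by simpa using hc, e.le_symm_apply.2 hac, e.le_symm_apply.2 hbc⟩) _ hs'
    (e.le_symm_apply.2 hxs)
  exact ⟨e y, hy, e.monotone hxy⟩

theorem isCompactIn_map_iff (e : X ≃o Y) {x : X} : IsCompactIn (e x) ↔ IsCompactIn x :=
  ⟨fun h => by simpa using isCompactIn_map e.symm h, isCompactIn_map e⟩

theorem isBooleanDomain_of_orderIso {X : Type*} {Y : Type*} [PartialOrder X] [PartialOrder Y]
    (e : X ≃o Y) (h : IsBooleanDomain Y) : IsBooleanDomain X := by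
  obtain ⟨h₁, h₂, h₃⟩ := h
  refine ⟨fun S => ?_, fun x => ?_, fun x hx => ?_⟩
  · obtain ⟨s, hs⟩ := h₁ (e '' S)
    exact ⟨e.symm s, e.isLUB_image.1 hs⟩
  · have := h₂ (e x)
    rw [← e.isLUB_preimage] at this
    convert this using 1
    ext k
    simp [isCompactIn_map_iff]
  · obtain ⟨n, ⟨f⟩⟩ := h₃ (e x) (isCompactIn_map e hx)
    exact ⟨n, ⟨(iicCongr e x).trans f⟩⟩

end Transfer

/-! ### Subalgebras of a finite power set as partitions. -/

section Partition

/-- The intersection of all members of `L` containing a point is again in `L` by finiteness, and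
consists of points that `L` does not separate from it. A saturated set is a finite union of such
classes. -/
theorem mem_of_saturated {ι : Type*} [Finite ι] {L : BooleanSubalgebra (Set ι)} {s : Set ι}
    (hs : ∀ i j, (∀ t ∈ L, i ∈ t ↔ j ∈ t) → (i ∈ s ↔ j ∈ s)) : s ∈ L := by
  have fin_inf : ∀ F : Set (Set ι), F.Finite → F ⊆ L → ⋂₀ F ∈ L := by
    intro F hF
    induction F, hF using Set.Finite.induction_on with
    | empty => intro _; rw [Set.sInter_empty]; exact BooleanSubalgebra.top_mem
    | insert _ _ ih =>
      intro h
      rw [Set.sInter_insert]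
      exact BooleanSubalgebra.inf_mem (h (Set.mem_insert _ _))
        (ih ((Set.subset_insert _ _).trans h))
  have fin_sup : ∀ F : Set (Set ι), F.Finite → F ⊆ L → ⋃₀ F ∈ L := by
    intro F hF
    induction F, hF using Set.Finite.induction_on with
    | empty => intro _; rw [Set.sUnion_empty]; exact BooleanSubalgebra.bot_mem
    | insert _ _ ih =>
      intro h
      rw [Set.sUnion_insert]
      exact BooleanSubalgebra.sup_mem (h (Set.mem_insert _ _))
        (ih ((Set.subset_insert _ _).trans h))
  let cls : ι → Set ι := fun i => ⋂₀ {t | t ∈ L ∧ i ∈ t}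
  have cls_mem : ∀ i, cls i ∈ L := fun i => fin_inf _ (Set.toFinite _) fun t ht => ht.1
  have cls_self : ∀ i, i ∈ cls i := fun i t ht => ht.2
  have cls_rel : ∀ i, ∀ j ∈ cls i, ∀ t ∈ L, i ∈ t ↔ j ∈ t := by
    intro i j hj t ht
    refine ⟨fun hi => hj t ⟨ht, hi⟩, fun hjt => ?_⟩
    by_contra hi
    exact hj tᶜ ⟨BooleanSubalgebra.compl_mem ht, hi⟩ hjt
  have e : s = ⋃₀ (cls '' s) := by
    ext j
    simp only [Set.mem_sUnion, Set.mem_image, exists_exists_and_eq_and]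
    exact ⟨fun hj => ⟨j, hj, cls_self j⟩,
      fun ⟨i, hi, hj⟩ => (hs i j (cls_rel i j hj)).1 hi⟩
  rw [e]
  refine fin_sup _ (Set.toFinite _) ?_
  rintro _ ⟨i, -, rfl⟩
  exact cls_mem i

/-- The subalgebras of a power set of a finite set are the partitions of this set, the coarsest
partition being the least subalgebra. -/
def subalgebraIsoSetoid (ι : Type*) [Finite ι] : BooleanSubalgebra (Set ι) ≃o (Setoid ι)ᵒᵈ where
  toFun L := OrderDual.toDual
    { r := fun i j => ∀ s ∈ L, i ∈ s ↔ j ∈ s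
      iseqv := ⟨fun _ _ _ => Iff.rfl, fun h s hs => (h s hs).symm,
        fun h h' s hs => (h s hs).trans (h' s hs)⟩ }
  invFun r :=
    { carrier := {s | ∀ i j, (OrderDual.ofDual r) i j → (i ∈ s ↔ j ∈ s)}
      bot_mem' := fun _ _ _ => Iff.rfl
      compl_mem' := fun h i j hij => not_congr (h i j hij)
      supClosed' := fun s hs t ht i j hij => or_congr (hs i j hij) (ht i j hij)
      infClosed' := fun s hs t ht i j hij => and_congr (hs i j hij) (ht i j hij) }
  left_inv L := by
    refine BooleanSubalgebra.ext fun s => ⟨fun hs => ?_, fun hs i j hij => hij s hs⟩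
    exact mem_of_saturated hs
  right_inv r := by
    refine congrArg OrderDual.toDual (Setoid.ext fun i j => ⟨fun h => ?_, fun h s hs => hs i j h⟩)
    -- The class of `i` is itself a saturated set, so it can be used as a test set.
    have := h {k | (OrderDual.ofDual r) i k} fun k l hkl =>
      ⟨fun h' => (OrderDual.ofDual r).trans' h' hkl,
        fun h' => (OrderDual.ofDual r).trans' h' ((OrderDual.ofDual r).symm' hkl)⟩
    exact this.1 ((OrderDual.ofDual r).refl' i)
  map_rel_iff' {L M} := ⟨fun h _ hs => mem_of_saturated fun _ _ hij => h hij _ hs,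
    fun h _ _ hij s hs => hij s (h hs)⟩

end Partition

/-! ### The subalgebra lattice of a Boolean algebra is a Boolean domain. -/

section Sub

variable {B : Type*} [BooleanAlgebra B]

/-- Isomorphic Boolean algebras have isomorphic subalgebra lattices. -/
def subalgebraCongr {C : Type*} [BooleanAlgebra C] (e : B ≃o C) :
    BooleanSubalgebra B ≃o BooleanSubalgebra C where
  toFun L := L.map (e : BoundedLatticeHom B C)
  invFun L := L.map (e.symm : BoundedLatticeHom C B)
  left_inv L := by
    refine BooleanSubalgebra.ext fun a => ⟨?_, fun h => ⟨e a, ⟨a, h, rfl⟩, e.symm_apply_apply a⟩⟩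
    rintro ⟨_, ⟨b, hb, rfl⟩, rfl⟩
    exact (e.symm_apply_apply b).symm ▸ hb
  right_inv L := by
    refine BooleanSubalgebra.ext fun a =>
      ⟨?_, fun h => ⟨e.symm a, ⟨a, h, rfl⟩, e.apply_symm_apply a⟩⟩
    rintro ⟨_, ⟨b, hb, rfl⟩, rfl⟩
    exact (e.apply_symm_apply b).symm ▸ hb
  map_rel_iff' {L M} := by
    refine ⟨fun h a ha => ?_, fun h => BooleanSubalgebra.map_mono h⟩
    obtain ⟨b, hb, hba⟩ := h ⟨a, ha, rfl⟩
    rwa [← e.injective hba]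

/-- The subalgebras below `L` are the subalgebras of `L`. -/
def iicSubalgebraIso (L : BooleanSubalgebra B) : Set.Iic L ≃o BooleanSubalgebra L where
  toFun M := M.1.comap L.subtype
  invFun M := ⟨M.map L.subtype, by
    rintro _ ⟨a, -, rfl⟩
    exact a.2⟩
  left_inv M := by
    refine Subtype.ext (BooleanSubalgebra.ext fun a => ⟨?_, fun h => ⟨⟨a, M.2 h⟩, h, rfl⟩⟩)
    rintro ⟨b, hb, rfl⟩
    exact hb
  right_inv M := by
    refine BooleanSubalgebra.ext fun a => ⟨?_, fun h => ⟨a, h, rfl⟩⟩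
    rintro ⟨b, hb, h⟩
    rwa [← L.subtype_injective h]
  map_rel_iff' {M N} := ⟨fun h a ha => h (show (⟨a, M.2 ha⟩ : L) ∈ _ from ha),
    fun h a ha => h ha⟩

theorem exists_iso_setoid (C : Type*) [BooleanAlgebra C] [Finite C] :
    ∃ n : ℕ, Nonempty (BooleanSubalgebra C ≃o (Setoid (Fin n))ᵒᵈ) := by
  cases nonempty_fintype C
  obtain ⟨ι, hι, ⟨e⟩⟩ : ∃ (ι : Type _) (_ : Finite ι), Nonempty (C ≃o Set ι) := by
    let _ := Fintype.toCompleteAtomicBooleanAlgebra C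
    exact ⟨{a : C // IsAtom a}, inferInstance, ⟨CompleteAtomicBooleanAlgebra.toSetOfIsAtom⟩⟩
  obtain ⟨n, ⟨f⟩⟩ := Finite.exists_equiv_fin ι
  let g : Set ι ≃o Set (Fin n) := { Equiv.Set.congr f with map_rel_iff' := by simp }
  exact ⟨n, ⟨(subalgebraCongr (e.trans g)).trans (subalgebraIsoSetoid _)⟩⟩

/-- A finite set generates a finite sublattice, and every element of the Boolean closure is a finite
join of differences of its members. -/
theorem finite_closure {s : Set B} (hs : s.Finite) :
    (BooleanSubalgebra.closure s : Set B).Finite := by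
  have hl : (latticeClosure (insert ⊥ (insert ⊤ s))).Finite :=
    ((hs.insert ⊤).insert ⊥).latticeClosure
  have := hl.to_subtype
  let F : Finset (latticeClosure (insert ⊥ (insert ⊤ s)) ×
      latticeClosure (insert ⊥ (insert ⊤ s))) → B := fun t => t.sup fun x => x.1.1 \ x.2.1
  refine (Set.finite_range F).subset fun a ha => ?_
  have ha' : a ∈ BooleanSubalgebra.closure (latticeClosure (insert ⊥ (insert ⊤ s))) :=
    BooleanSubalgebra.closure_mono (((Set.subset_insert _ _).trans
      (Set.subset_insert _ _)).trans subset_latticeClosure) ha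
  obtain ⟨t, rfl⟩ := (BooleanSubalgebra.mem_closure_iff_sup_sdiff isSublattice_latticeClosure
    (subset_latticeClosure (by simp)) (subset_latticeClosure (by simp))).1 ha'
  exact ⟨t, rfl⟩

/-- The union of a directed family of subalgebras. -/
def directedUnion (D : Set (BooleanSubalgebra B)) (hne : D.Nonempty)
    (hD : DirectedOn (· ≤ ·) D) : BooleanSubalgebra B where
  carrier := {a | ∃ L ∈ D, a ∈ L}
  bot_mem' := ⟨_, hne.choose_spec, BooleanSubalgebra.bot_mem⟩
  compl_mem' := fun ⟨L, hL, h⟩ => ⟨L, hL, BooleanSubalgebra.compl_mem h⟩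
  supClosed' := by
    rintro a ⟨L, hL, ha⟩ b ⟨M, hM, hb⟩
    obtain ⟨N, hN, h₁, h₂⟩ := hD L hL M hM
    exact ⟨N, hN, BooleanSubalgebra.sup_mem (h₁ ha) (h₂ hb)⟩
  infClosed' := by
    rintro a ⟨L, hL, ha⟩ b ⟨M, hM, hb⟩
    obtain ⟨N, hN, h₁, h₂⟩ := hD L hL M hM
    exact ⟨N, hN, BooleanSubalgebra.inf_mem (h₁ ha) (h₂ hb)⟩

theorem isCompactIn_gen (a : B) : IsCompactIn (gen a) := by
  intro D hne hD s hs h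
  have : s ≤ directedUnion D hne hD := hs.2 fun L hL b hb => ⟨L, hL, hb⟩
  obtain ⟨L, hL, ha⟩ := this (h (self_mem_gen a))
  exact ⟨L, hL, gen_le.2 ha⟩

/-- `L` is the directed join of its finite subalgebras, so by compactness it is contained in one of
them. -/
theorem finite_of_isCompactIn {L : BooleanSubalgebra B} (h : IsCompactIn L) :
    (L : Set B).Finite := by
  let D : Set (BooleanSubalgebra B) := {M | M ≤ L ∧ (M : Set B).Finite}
  have hdir : DirectedOn (· ≤ ·) D := by
    rintro M ⟨hM, hMf⟩ N ⟨hN, hNf⟩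
    refine ⟨BooleanSubalgebra.closure (M ∪ N), ⟨?_, finite_closure (hMf.union hNf)⟩, ?_, ?_⟩
    · exact BooleanSubalgebra.closure_le.2 (Set.union_subset hM hN)
    · exact Set.subset_union_left.trans BooleanSubalgebra.subset_closure
    · exact Set.subset_union_right.trans BooleanSubalgebra.subset_closure
  have hlub : IsLUB D L := by
    refine ⟨fun M hM => hM.1, fun U hU a ha => ?_⟩
    refine hU (a := gen a) ⟨gen_le.2 ha, ?_⟩ (self_mem_gen a)
    exact (Set.toFinite {⊥, a, aᶜ, ⊤}).subset fun b hb => hb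
  obtain ⟨M, hM, hLM⟩ := h D ⟨⊥, bot_le, by simp⟩ hdir L hlub le_rfl
  exact hM.2.subset hLM

theorem isBooleanDomain_booleanSubalgebra : IsBooleanDomain (BooleanSubalgebra B) := by
  refine ⟨fun S => ⟨_, isLUB_sSup S⟩, fun L => ⟨fun k hk => hk.2, fun U hU a ha => ?_⟩,
    fun L hL => ?_⟩
  · exact hU (a := gen a) ⟨isCompactIn_gen a, gen_le.2 ha⟩ (self_mem_gen a)
  · have : Finite L := finite_of_isCompactIn hL
    obtain ⟨n, ⟨e⟩⟩ := exists_iso_setoid L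
    exact ⟨n, ⟨(iicSubalgebraIso L).trans e⟩⟩

end Sub

theorem isBooleanDomain_iic {A : Type u} [OrthoOps A] [IsOrthoalgebra A] (y : BSub A) :
    IsBooleanDomain (Set.Iic y) :=
  isBooleanDomain_of_orderIso (BSub.iicIso y) isBooleanDomain_booleanSubalgebra

/-! ### Embedded intervals, as pieces for gluing. -/

open OrthoOps IsOrthoalgebra
noncomputable instance iicBooleanAlgebra {B : Type*} [BooleanAlgebra B] (b : B) :
    BooleanAlgebra (Set.Iic b) :=
  let _ : DistribLattice (Set.Iic b) :=
    { (inferInstance : Lattice (Set.Iic b)) with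
      le_sup_inf := fun x y z => le_sup_inf (x := x.1) (y := y.1) (z := z.1) }
  DistribLattice.booleanAlgebraOfComplemented (Set.Iic b)
namespace IsBoolEmb
variable {A : Type u} [OrthoOps A] [IsOrthoalgebra A] {B C : Type*} [BooleanAlgebra B]
  [BooleanAlgebra C] {f : B → A} {g : C → A} {s t w : A}

theorem isBoolEmb_iic (hf : IsBoolEmb f t) (b : B) :
    IsBoolEmb (fun x : Set.Iic b => f x.1) (f b) where
  map_sum x y h := hf.map_sum x.1 y.1 (by
    rw [disjoint_iff] at h ⊢
    exact congrArg Subtype.val h)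
  map_top := rfl
  eq_bot x h := Subtype.ext (hf.eq_bot x.1 h)

theorem mem_range_sum (hf : IsBoolEmb f s) (hg : IsBoolEmb g t) (h : OSum s t 1) {c : A} :
    c ∈ (isBoolEmb_sum hf hg h).range.carrier ↔ ∃ x y, OSum (f x) (g y) c := by
  constructor
  · rintro ⟨⟨x, y⟩, rfl⟩
    exact ⟨x, y, sum_spec hf hg h x y⟩
  · rintro ⟨x, y, hc⟩
    exact ⟨(x, y), uniq (sum_spec hf hg h x y) hc⟩

end IsBoolEmb

/-! ### Atoms of `BSub A` and their covers. -/

section Elements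

variable {A : Type u} [OrthoOps A] [IsOrthoalgebra A] {a b c e f s : A} {x y z w : BSub A}

theorem mem_bot : a ∈ (⊥ : BSub A).carrier ↔ a = 0 ∨ a = 1 := Iff.rfl

open Classical in
/-- The Boolean subalgebra `{0, a, a', 1}`. -/
noncomputable def four (a : A) : BSub A :=
  -- Faithfulness of the two pieces needs `a` and `a'` nonzero; in the excluded cases the set is
  -- `{0, 1}`.
  if h : a ≠ 0 ∧ a ≠ 1 then
    (IsBoolEmb.isBoolEmb_sum (isBoolEmb_bool h.1) (isBoolEmb_bool (mt oc_eq_zero.1 h.2))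
      (sum_oc a)).range
  else ⊥

theorem mem_four : b ∈ (four a).carrier ↔ b = 0 ∨ b = a ∨ b = oc a ∨ b = 1 := by
  unfold four
  split_ifs with h
  · rw [IsBoolEmb.mem_range_sum (isBoolEmb_bool h.1) (isBoolEmb_bool (mt oc_eq_zero.1 h.2))
      (sum_oc a)]
    constructor
    · rintro ⟨x | x, y | y, hc⟩
      · exact Or.inl (uniq hc (zero_sum _))
      · exact Or.inr (Or.inr (Or.inl (uniq hc (zero_sum _))))
      · exact Or.inr (Or.inl (uniq hc (ortho_sum_zero _)))
      · exact Or.inr (Or.inr (Or.inr (uniq hc (sum_oc _))))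
    · rintro (rfl | rfl | rfl | rfl)
      · exact ⟨false, false, zero_sum 0⟩
      · exact ⟨true, false, ortho_sum_zero b⟩
      · exact ⟨false, true, zero_sum _⟩
      · exact ⟨true, true, sum_oc _⟩
  · rw [mem_bot]
    by_cases h0 : a = 0
    · subst h0
      rw [ortho_oc_zero]
      tauto
    · have h1 : a = 1 := by tauto
      subst h1
      rw [ortho_oc_one]
      tauto

theorem self_mem_four (a : A) : a ∈ (four a).carrier := mem_four.2 (Or.inr (Or.inl rfl))

theorem four_le_iff : four a ≤ y ↔ a ∈ y.carrier := by
  refine ⟨fun h => h (self_mem_four a), fun h b hb => ?_⟩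
  rcases mem_four.1 hb with rfl | rfl | rfl | rfl
  · exact y.zero_mem
  · exact h
  · exact y.oc_mem _ h
  · exact y.one_mem

theorem four_oc (a : A) : four (oc a) = four a :=
  le_antisymm (four_le_iff.2 ((four a).oc_mem _ (self_mem_four a)))
    (four_le_iff.2 (BSub.oc_mem_iff.1 (self_mem_four (oc a))))

theorem four_eq_bot_iff : four a = ⊥ ↔ a = 0 ∨ a = 1 := by
  rw [← le_bot_iff, four_le_iff, mem_bot]

theorem four_eq_four_iff : four a = four b ↔ a = b ∨ a = oc b := by
  constructor
  · intro h
    have ha : a ∈ (four b).carrier := h ▸ self_mem_four a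
    have hb : b ∈ (four a).carrier := h ▸ self_mem_four b
    rcases mem_four.1 ha with rfl | h | h | rfl
    · rcases mem_four.1 hb with rfl | rfl | rfl | rfl
      · exact Or.inl rfl
      · exact Or.inl rfl
      · rw [oc_oc]; exact Or.inr rfl
      · exact Or.inr ortho_oc_one.symm
    · exact Or.inl h
    · exact Or.inr h
    · rcases mem_four.1 hb with rfl | rfl | rfl | rfl
      · exact Or.inr ortho_oc_zero.symm
      · exact Or.inl rfl
      · rw [oc_oc]; exact Or.inr rfl
      · exact Or.inl rfl
  · rintro (rfl | rfl)
    · rfl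
    · exact four_oc b

theorem isAtom_four (h0 : a ≠ 0) (h1 : a ≠ 1) : IsAtom (four a) := by
  refine ⟨fun h => ?_, fun y hy => le_bot_iff.1 fun b hb => ?_⟩
  · rcases four_eq_bot_iff.1 h with h | h
    · exact h0 h
    · exact h1 h
  · have hna : a ∉ y.carrier := fun hn => hy.not_ge (four_le_iff.2 hn)
    rcases mem_four.1 (hy.le hb) with rfl | rfl | rfl | rfl
    · exact Or.inl rfl
    · exact absurd hb hna
    · exact absurd (BSub.oc_mem_iff.1 hb) hna
    · exact Or.inr rfl

theorem isAtom_iff : IsAtom x ↔ ∃ a, a ≠ 0 ∧ a ≠ 1 ∧ x = four a := by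
  constructor
  · rintro ⟨h, h'⟩
    obtain ⟨a, ha, hn⟩ : ∃ a ∈ x.carrier, a ∉ (⊥ : BSub A).carrier := by
      by_contra! hcon
      exact h (le_bot_iff.1 hcon)
    rw [mem_bot, not_or] at hn
    refine ⟨a, hn.1, hn.2, ?_⟩
    rcases (four_le_iff.2 ha).eq_or_lt with e | e
    · exact e.symm
    · rcases four_eq_bot_iff.1 (h' _ e) with e | e
      · exact absurd e hn.1
      · exact absurd e hn.2
  · rintro ⟨a, h0, h1, rfl⟩
    exact isAtom_four h0 h1

theorem isBasic_four (a : A) : IsBasic (four a) := by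
  by_cases h : a = 0 ∨ a = 1
  · exact Or.inl (four_eq_bot_iff.2 h)
  · rw [not_or] at h
    exact Or.inr (isAtom_four h.1 h.2)

theorem isBasic_iff : IsBasic x ↔ ∃ a, x = four a := by
  constructor
  · rintro (rfl | h)
    · exact ⟨0, (four_eq_bot_iff.2 (Or.inl rfl)).symm⟩
    · obtain ⟨a, -, -, h⟩ := isAtom_iff.1 h
      exact ⟨a, h⟩
  · rintro ⟨a, rfl⟩
    exact isBasic_four a

theorem isBoolEmb_eight (h : OSum e f s) (he : e ≠ 0) (hf : f ≠ 0) (hs : s ≠ 1) :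
    IsBoolEmb (IsBoolEmb.sum (IsBoolEmb.sum (fun b : Bool => if b then e else 0)
      (fun b : Bool => if b then f else 0)) (fun b : Bool => if b then oc s else 0)) 1 :=
  IsBoolEmb.isBoolEmb_sum (IsBoolEmb.isBoolEmb_sum (isBoolEmb_bool he) (isBoolEmb_bool hf) h)
    (isBoolEmb_bool (mt oc_eq_zero.1 hs)) (sum_oc s)

/-- The Boolean subalgebra with the atoms `e`, `f` and `(e ⊕ f)'`. -/
noncomputable def eight (h : OSum e f s) (he : e ≠ 0) (hf : f ≠ 0) (hs : s ≠ 1) : BSub A :=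
  (isBoolEmb_eight h he hf hs).range

section Eight

variable {h : OSum e f s} {he : e ≠ 0} {hf : f ≠ 0} {hs : s ≠ 1}

theorem mem_eight_iff_exists : c ∈ (eight h he hf hs).carrier ↔ ∃ x y z : Bool, ∃ p,
    OSum (if x then e else 0) (if y then f else 0) p ∧ OSum p (if z then oc s else 0) c := by
  have hp := IsBoolEmb.sum_spec (isBoolEmb_bool he) (isBoolEmb_bool hf) h
  refine (IsBoolEmb.mem_range_sum
    (IsBoolEmb.isBoolEmb_sum (isBoolEmb_bool he) (isBoolEmb_bool hf) h)
    (isBoolEmb_bool (mt oc_eq_zero.1 hs)) (sum_oc s)).trans ⟨?_, ?_⟩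
  · rintro ⟨⟨x, y⟩, z, hc⟩
    exact ⟨x, y, z, _, hp x y, hc⟩
  · rintro ⟨x, y, z, p, hxy, hc⟩
    exact ⟨(x, y), z, uniq (hp x y) hxy ▸ hc⟩

theorem left_mem_eight : e ∈ (eight h he hf hs).carrier :=
  mem_eight_iff_exists.2 ⟨true, false, false, e, ortho_sum_zero e, ortho_sum_zero e⟩

theorem right_mem_eight : f ∈ (eight h he hf hs).carrier :=
  mem_eight_iff_exists.2 ⟨false, true, false, f, zero_sum f, ortho_sum_zero f⟩

theorem sum_mem_eight : s ∈ (eight h he hf hs).carrier :=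
  OrthoSubalgebra.sum_mem _ _ _ _ left_mem_eight right_mem_eight h

/-- The third atom is `s'`, and the sums of it with `e` and `f` are `f'` and `e'`. So up to
complement only `0`, `e`, `f`, `s` occur. -/
theorem mem_eight (hc : c ∈ (eight h he hf hs).carrier) :
    c ∈ (four e).carrier ∨ c ∈ (four f).carrier ∨ c ∈ (four s).carrier := by
  simp only [mem_four]
  obtain ⟨x, y, z, p, hs1, hc⟩ := mem_eight_iff_exists.1 hc
  rcases x with _ | _ <;> rcases y with _ | _
  · rw [uniq hs1 (zero_sum _)] at hc
    rw [uniq hc (zero_sum _)]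
    rcases z with _ | _ <;> simp
  · rw [uniq hs1 (zero_sum _)] at hc
    rcases z with _ | _
    · rw [uniq hc (ortho_sum_zero _)]; simp
    · rw [uniq hc (rotate h)]; simp
  · rw [uniq hs1 (ortho_sum_zero _)] at hc
    rcases z with _ | _
    · rw [uniq hc (ortho_sum_zero _)]; simp
    · rw [uniq hc (rotate (comm h))]; simp
  · rw [uniq hs1 h] at hc
    rcases z with _ | _
    · rw [uniq hc (ortho_sum_zero _)]; simp
    · rw [uniq hc (sum_oc _)]; simp

theorem eight_le_iff : eight h he hf hs ≤ y ↔ e ∈ y.carrier ∧ f ∈ y.carrier := by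
  refine ⟨fun h' => ⟨h' left_mem_eight, h' right_mem_eight⟩, fun ⟨h₁, h₂⟩ c hc => ?_⟩
  rcases mem_eight hc with hc | hc | hc
  · exact four_le_iff.2 h₁ hc
  · exact four_le_iff.2 h₂ hc
  · exact four_le_iff.2 (y.sum_mem _ _ _ h₁ h₂ h) hc

theorem four_le_eight : four e ≤ eight h he hf hs := four_le_iff.2 left_mem_eight

theorem notMem_four_of_sum (h : OSum e f s) (he : e ≠ 0) (hf : f ≠ 0) (hs : s ≠ 1) :
    f ∉ (four e).carrier := by
  intro hm
  rcases mem_four.1 hm with rfl | rfl | rfl | rfl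
  · exact hf rfl
  · exact he (eq_zero_of_sum_self h)
  · exact hs (uniq h (sum_oc e))
  · have := orth_iff.1 ⟨_, comm h⟩
    rw [ortho_oc_one] at this
    exact he (le_zero this)

/-- Anything strictly larger than `four e` inside contains `f` or `s`, and from `s` it recovers `f`
by subtracting `e`. -/
theorem four_covBy_eight : four e ⋖ eight h he hf hs := by
  refine ⟨lt_of_le_not_ge four_le_eight fun h' =>
    notMem_four_of_sum h he hf hs (h' right_mem_eight), fun v hv hv' => hv'.not_ge ?_⟩
  have hev : e ∈ v.carrier := four_le_iff.1 hv.le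
  refine eight_le_iff.2 ⟨hev, ?_⟩
  obtain ⟨c, hc, hce⟩ := Set.not_subset.1 hv.not_ge
  have key : ∀ d, c ∈ (four d).carrier → d ∈ v.carrier := by
    intro d hd
    rcases mem_four.1 hd with rfl | rfl | rfl | rfl
    · exact absurd (OrthoSubalgebra.zero_mem _) hce
    · exact hc
    · exact BSub.oc_mem_iff.1 hc
    · exact absurd (OrthoSubalgebra.one_mem _) hce
  rcases mem_eight (hv'.le hc) with hc' | hc' | hc'
  · exact absurd hc' hce
  · exact key _ hc'
  · exact BSub.mem_of_sum hev (key _ hc') h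

theorem isLUB_eight : IsLUB {four e, four f} (eight h he hf hs) := by
  constructor
  · rintro _ (rfl | rfl)
    · exact four_le_eight
    · exact four_le_iff.2 right_mem_eight
  · intro u hu
    exact eight_le_iff.2 ⟨four_le_iff.1 (hu (by simp)), four_le_iff.1 (hu (by simp))⟩

theorem eight_comm : eight h he hf hs = eight (comm h) hf he hs :=
  le_antisymm (eight_le_iff.2 ⟨right_mem_eight, left_mem_eight⟩)
    (eight_le_iff.2 ⟨right_mem_eight, left_mem_eight⟩)

theorem eight_rotate : eight h he hf hs =
    eight (rotate h) hf (mt oc_eq_zero.1 hs) (mt oc_eq_one.1 he) :=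
  le_antisymm
    (eight_le_iff.2 ⟨BSub.oc_mem_iff.1 sum_mem_eight, left_mem_eight⟩)
    (eight_le_iff.2 ⟨right_mem_eight, OrthoSubalgebra.oc_mem _ _ sum_mem_eight⟩)

end Eight

/-- Split some `p ∈ y` outside `four a` into `p ⊓ a` and `p ⊓ a'`. One part is still outside `four
a`, and it is orthogonal to `a'` or to `a` respectively; that element serves as `e`. -/
theorem exists_eight_le (h0 : a ≠ 0) (h1 : a ≠ 1) (hay : four a < y) :
    ∃ (e f s : A) (h : OSum e f s) (he : e ≠ 0) (hf : f ≠ 0) (hs : s ≠ 1),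
      four e = four a ∧ eight h he hf hs ≤ y := by
  have key : ∀ b f : A, b ≠ 0 → b ≠ 1 → b ∈ y.carrier → f ∈ y.carrier → OrthoLE f (oc b) →
      f ∉ (four b).carrier →
      ∃ (f s : A) (h : OSum b f s) (he : b ≠ 0) (hf : f ≠ 0) (hs : s ≠ 1),
        eight h he hf hs ≤ y := by
    intro b f h0 h1 hb hf hle hn
    obtain ⟨s, hs⟩ := orth_iff.2 hle
    refine ⟨f, s, hs, h0, ?_, ?_, eight_le_iff.2 ⟨hb, hf⟩⟩
    · rintro rfl
      exact hn (OrthoSubalgebra.zero_mem _)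
    · rintro rfl
      rw [(sum_eq_one_iff _ _).1 hs] at hn
      exact hn (OrthoSubalgebra.oc_mem _ _ (self_mem_four b))
  obtain ⟨p, hp, hn⟩ := Set.not_subset.1 hay.not_ge
  have ha : a ∈ y.carrier := four_le_iff.1 hay.le
  let p' : y.carrier := ⟨p, hp⟩
  let a' : y.carrier := ⟨a, ha⟩
  by_cases h₁ : (p' ⊓ a').1 ∈ (four a).carrier
  · by_cases h₂ : (p' ⊓ a'ᶜ).1 ∈ (four a).carrier
    · have hsum := y.isBoolEmb.map_sum (p' ⊓ a') (p' ⊓ a'ᶜ)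
        (disjoint_compl_right.mono inf_le_right inf_le_right)
      rw [← sdiff_eq, sup_inf_sdiff, sdiff_eq] at hsum
      exact absurd (OrthoSubalgebra.sum_mem _ _ _ _ h₁ h₂ hsum) hn
    · have hle := BSub.le_iff.1 (inf_le_right : p' ⊓ a'ᶜ ≤ a'ᶜ)
      rw [BSub.coe_compl] at hle
      obtain ⟨f, s, h, he, hf, hs, hy⟩ := key a _ h0 h1 ha (p' ⊓ a'ᶜ).2 hle h₂
      exact ⟨a, f, s, h, he, hf, hs, rfl, hy⟩
  · have hle := BSub.le_iff.1 (inf_le_right : p' ⊓ a' ≤ a')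
    obtain ⟨f, s, h, he, hf, hs, hy⟩ := key (oc a) _ (mt oc_eq_zero.1 h1) (mt oc_eq_one.1 h0)
      (y.oc_mem _ ha) (p' ⊓ a').2 (by rwa [oc_oc]) (by rwa [four_oc])
    exact ⟨oc a, f, s, h, he, hf, hs, four_oc a, hy⟩

theorem exists_cover_le (h : four a < y) : ∃ w, four a ⋖ w ∧ w ≤ y := by
  by_cases h01 : a = 0 ∨ a = 1
  · rw [four_eq_bot_iff.2 h01] at h ⊢
    obtain ⟨b, hb, hn⟩ := Set.not_subset.1 h.not_ge
    rw [mem_bot, not_or] at hn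
    exact ⟨four b, bot_covBy_iff.2 (isAtom_four hn.1 hn.2), four_le_iff.2 hb⟩
  · rw [not_or] at h01
    obtain ⟨e, f, s, hsum, he, hf, hs, hea, hy⟩ := exists_eight_le h01.1 h01.2 h
    exact ⟨_, hea ▸ four_covBy_eight, hy⟩

theorem eight_eq_of_covBy {h : OSum e f s} {he : e ≠ 0} {hf : f ≠ 0} {hs : s ≠ 1}
    (hw : four e ⋖ w) (hle : eight h he hf hs ≤ w) : eight h he hf hs = w :=
  (hw.eq_or_eq four_le_eight hle).resolve_left four_covBy_eight.lt.ne'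

/-- A cover of an atom is an eight-element subalgebra. The atoms of `BSub A` below it come from `e`,
`f` and `s'`, any two of which generate it. -/
theorem isLUB_of_covBy {x y w : BSub A} (hx : IsAtom x) (hy : IsAtom y) (hxy : x ≠ y)
    (hxw : x ⋖ w) (hyw : y ⋖ w) : IsLUB {x, y} w := by
  obtain ⟨a, ha0, ha1, rfl⟩ := isAtom_iff.1 hx
  obtain ⟨b, hb0, hb1, rfl⟩ := isAtom_iff.1 hy
  obtain ⟨e, f, s, h, he, hf, hs, hea, hle⟩ := exists_eight_le ha0 ha1 hxw.lt
  rw [← hea] at hxw hxy ⊢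
  obtain rfl := eight_eq_of_covBy hxw hle
  have key : ∀ d, b ∈ (four d).carrier → four b = four d := by
    intro d hd
    rcases mem_four.1 hd with rfl | rfl | rfl | rfl
    · exact absurd rfl hb0
    · rfl
    · exact four_oc d
    · exact absurd rfl hb1
  rcases mem_eight (four_le_iff.1 hyw.le) with hb | hb | hb
  · exact absurd (key _ hb).symm hxy
  · rw [key _ hb]
    exact isLUB_eight
  · rw [key _ hb, eight_comm, eight_rotate, ← four_oc s]
    exact isLUB_eight

end Elements

/-! ### Directed joins, and the orthodomain axioms. -/

section Orthodomain

variable {A : Type u} [OrthoOps A] [IsOrthoalgebra A]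

/-- The union of a directed family of Boolean subalgebras. -/
def directedSup (D : Set (BSub A)) (hne : D.Nonempty) (hD : DirectedOn (· ≤ ·) D) : BSub A :=
  let S : OrthoSubalgebra A :=
    { carrier := ⋃ y ∈ D, y.carrier
      zero_mem := Set.mem_biUnion hne.choose_spec (OrthoSubalgebra.zero_mem _)
      one_mem := Set.mem_biUnion hne.choose_spec (OrthoSubalgebra.one_mem _)
      oc_mem := by
        intro a ha
        simp only [Set.mem_iUnion] at ha ⊢
        obtain ⟨y, hy, ha⟩ := ha
        exact ⟨y, hy, y.oc_mem _ ha⟩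
      sum_mem := by
        intro a b c ha hb h
        simp only [Set.mem_iUnion] at ha hb ⊢
        obtain ⟨y, hy, ha⟩ := ha
        obtain ⟨z, hz, hb⟩ := hb
        obtain ⟨w, hw, hyw, hzw⟩ := hD y hy z hz
        exact ⟨w, hw, w.sum_mem _ _ _ (hyw ha) (hzw hb) h⟩ }
  ⟨S, isBoolean_of_directed hD rfl⟩

theorem isLUB_directedSup (D : Set (BSub A)) (hne : D.Nonempty) (hD : DirectedOn (· ≤ ·) D) :
    IsLUB D (directedSup D hne hD) := by
  constructor
  · intro y hy a ha
    exact Set.mem_biUnion hy ha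
  · intro u hu a ha
    have ha' : a ∈ ⋃ y ∈ D, y.carrier := ha
    simp only [Set.mem_iUnion] at ha'
    obtain ⟨y, hy, ha⟩ := ha'
    exact hu hy ha

theorem isCompactIn_four (a : A) : IsCompactIn (four a) := by
  intro D hne hD s hs h
  obtain rfl := hs.unique (isLUB_directedSup D hne hD)
  have ha : a ∈ ⋃ y ∈ D, y.carrier := four_le_iff.1 h
  simp only [Set.mem_iUnion] at ha
  obtain ⟨y, hy, ha⟩ := ha
  exact ⟨y, hy, four_le_iff.2 ha⟩

theorem isOrthodomain (A : Type u) [OrthoOps A] [IsOrthoalgebra A] : IsOrthodomain (BSub A) where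
  directed_join D hne hD := ⟨_, isLUB_directedSup D hne hD⟩
  atomistic y := by
    refine ⟨fun x hx => hx.2, fun u hu a ha => ?_⟩
    by_cases h0 : a = 0
    · exact h0 ▸ u.zero_mem
    by_cases h1 : a = 1
    · exact h1 ▸ u.one_mem
    exact four_le_iff.1 (hu ⟨isAtom_four h0 h1, four_le_iff.2 ha⟩)
  atom_compact x hx := by
    obtain ⟨a, -, -, rfl⟩ := isAtom_iff.1 hx
    exact isCompactIn_four a
  ideal_boolean := isBooleanDomain_iic
  join_of_cover x y w := isLUB_of_covBy

end Orthodomain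

/-! ### The subalgebras `↓a ∪ ↑a'` of `y`, and common covers by gluing. -/

section IdealSub

variable {A : Type u} [OrthoOps A] [IsOrthoalgebra A] {a b c : A} {x y z u : BSub A}

/-- The Boolean subalgebra of `y` made of the elements of `y` below `a` and those above `a'`. -/
noncomputable def idealSub (y : BSub A) (a : A) (ha : a ∈ y.carrier) : BSub A :=
  ((BSub.iicIso y).symm (principal ⟨a, ha⟩)).1

theorem mem_idealSub {ha : a ∈ y.carrier} :
    b ∈ (idealSub y a ha).carrier ↔ b ∈ y.carrier ∧ (OrthoLE b a ∨ OrthoLE (oc a) b) := by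
  rw [idealSub, BSub.mem_iicIso_symm]
  simp only [mem_principal, BSub.le_iff, BSub.coe_compl, exists_prop]

theorem idealSub_le {ha : a ∈ y.carrier} : idealSub y a ha ≤ y := fun _ hb => (mem_idealSub.1 hb).1

theorem idealSub_oc_oc {ha : oc (oc a) ∈ y.carrier} (ha' : a ∈ y.carrier) :
    idealSub y (oc (oc a)) ha = idealSub y a ha' := by
  congr 1
  exact oc_oc a

theorem iicIso_four (ha : a ∈ y.carrier) (h : four a ≤ y) :
    BSub.iicIso y ⟨four a, h⟩ = gen ⟨a, ha⟩ := by
  refine BooleanSubalgebra.ext fun b => ?_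
  rw [BSub.mem_iicIso, mem_four, mem_gen]
  simp only [Subtype.ext_iff, BSub.coe_bot, BSub.coe_top, BSub.coe_compl]

theorem isPrincipalPairFor_four_iff (ha : a ∈ y.carrier) (h : four a ≤ y) {Y Z : Set.Iic y} :
    IsPrincipalPairFor (⟨four a, h⟩ : Set.Iic y) Y Z ↔
      (Y.1 = idealSub y a ha ∧ Z.1 = idealSub y (oc a) (y.oc_mem _ ha)) ∨
      (Y.1 = idealSub y (oc a) (y.oc_mem _ ha) ∧ Z.1 = idealSub y a ha) := by
  have hc : (⟨oc a, y.oc_mem _ ha⟩ : y.carrier) = (⟨a, ha⟩ : y.carrier)ᶜ :=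
    Subtype.ext (BSub.coe_compl (⟨a, ha⟩ : y.carrier)).symm
  rw [← isPrincipalPairFor_map (BSub.iicIso y), iicIso_four ha, isPrincipalPairFor_gen_iff,
    idealSub, idealSub, ← Subtype.ext_iff, ← Subtype.ext_iff, ← Subtype.ext_iff, ← Subtype.ext_iff,
    hc, OrderIso.eq_symm_apply, OrderIso.eq_symm_apply, OrderIso.eq_symm_apply,
    OrderIso.eq_symm_apply]

theorem mem_four_of_mem_idealSub {ha : a ∈ y.carrier} {ha' : oc a ∈ y.carrier}
    (h : b ∈ (idealSub y a ha).carrier) (h' : b ∈ (idealSub y (oc a) ha').carrier) :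
    b ∈ (four a).carrier := by
  have h4 : four a ≤ y := four_le_iff.2 ha
  have hglb := ((isPrincipalPairFor_four_iff ha h4 (Y := ⟨idealSub y a ha, idealSub_le⟩)
    (Z := ⟨idealSub y (oc a) ha', idealSub_le⟩)).2 (Or.inl ⟨rfl, rfl⟩)).2
  have hle : (⟨four b, four_le_iff.2 (idealSub_le h)⟩ : Set.Iic y) ≤ ⟨four a, h4⟩ := by
    refine hglb.2 ?_
    rintro _ (rfl | rfl)
    · exact four_le_iff.2 h
    · exact four_le_iff.2 h'
  exact four_le_iff.1 hle

theorem four_le_idealSub {ha : a ∈ y.carrier} : four a ≤ idealSub y a ha :=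
  four_le_iff.2 (mem_idealSub.2 ⟨ha, Or.inl (ole_refl a)⟩)

theorem four_le_idealSub_oc {ha : oc a ∈ y.carrier} : four a ≤ idealSub y (oc a) ha :=
  four_oc a ▸ four_le_idealSub

theorem exists_split (ha : a ∈ y.carrier) (hc : c ∈ y.carrier) :
    ∃ p ∈ y.carrier, ∃ q ∈ y.carrier, OrthoLE p a ∧ OrthoLE q (oc a) ∧ OSum p q c := by
  let c' : y.carrier := ⟨c, hc⟩
  let a' : y.carrier := ⟨a, ha⟩
  have hsum := y.isBoolEmb.map_sum (c' ⊓ a') (c' ⊓ a'ᶜ)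
    (disjoint_compl_right.mono inf_le_right inf_le_right)
  rw [← sdiff_eq, sup_inf_sdiff, sdiff_eq] at hsum
  have hle := BSub.le_iff.1 (inf_le_right : c' ⊓ a'ᶜ ≤ a'ᶜ)
  rw [BSub.coe_compl] at hle
  exact ⟨_, (c' ⊓ a').2, _, (c' ⊓ a'ᶜ).2, BSub.le_iff.1 inf_le_right, hle, hsum⟩

theorem le_of_idealSub_le {ha : a ∈ y.carrier} {ha' : oc a ∈ y.carrier}
    (h : idealSub y a ha ≤ z) (h' : idealSub y (oc a) ha' ≤ z) : y ≤ z := by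
  intro c hc
  obtain ⟨p, hp, q, hq, hpa, hqa, hsum⟩ := exists_split ha hc
  exact z.sum_mem _ _ _ (h (mem_idealSub.2 ⟨hp, Or.inl hpa⟩))
    (h' (mem_idealSub.2 ⟨hq, Or.inl hqa⟩)) hsum

/-- If they coincided, both would lie in `four a`, although together they generate `y`. So above the
base the two choices are distinguishable. -/
theorem idealSub_ne (h : four a < y) (ha : a ∈ y.carrier) (ha' : oc a ∈ y.carrier) :
    idealSub y a ha ≠ idealSub y (oc a) ha' := by
  intro e
  have h1 : idealSub y a ha ≤ four a := fun b hb =>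
    mem_four_of_mem_idealSub hb (e ▸ hb : b ∈ (idealSub y (oc a) ha').carrier)
  exact h.not_ge (le_of_idealSub_le h1 (e ▸ h1))

theorem idealSub_of_covBy (h : four a ⋖ y) (ha : a ∈ y.carrier) (ha' : oc a ∈ y.carrier) :
    (idealSub y a ha = four a ∧ idealSub y (oc a) ha' = y) ∨
      (idealSub y a ha = y ∧ idealSub y (oc a) ha' = four a) := by
  rcases h.eq_or_eq (four_le_idealSub (ha := ha)) idealSub_le with h1 | h1 <;>
    rcases h.eq_or_eq (four_le_idealSub_oc (ha := ha')) idealSub_le with h2 | h2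
  · exact absurd (h1.trans h2.symm) (idealSub_ne h.lt ha ha')
  · exact Or.inl ⟨h1, h2⟩
  · exact Or.inr ⟨h1, h2⟩
  · exact absurd (h1.trans h2.symm) (idealSub_ne h.lt ha ha')

theorem isGLB_idealSub (h : y ≤ z) (ha : a ∈ y.carrier) :
    IsGLB {y, idealSub z a (h ha)} (idealSub y a ha) := by
  constructor
  · rintro _ (rfl | rfl)
    · exact idealSub_le
    · intro b hb
      rw [mem_idealSub] at hb ⊢
      exact ⟨h hb.1, hb.2⟩
  · intro t ht b hb
    have h₂ : t ≤ idealSub z a (h ha) := ht (by simp)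
    exact mem_idealSub.2 ⟨ht (Set.mem_insert _ _) hb, (mem_idealSub.1 (h₂ hb)).2⟩

/-- The common bound `u` makes the intersection Boolean, as a meet of subalgebras of one Boolean
algebra. -/
theorem exists_inter (hx : x ≤ u) (hy : y ≤ u) :
    ∃ t : BSub A, ∀ a, a ∈ t.carrier ↔ a ∈ x.carrier ∧ a ∈ y.carrier := by
  refine ⟨((BSub.iicIso u).symm (BSub.iicIso u ⟨x, hx⟩ ⊓ BSub.iicIso u ⟨y, hy⟩)).1, fun a => ?_⟩
  rw [BSub.mem_iicIso_symm]
  exact ⟨fun ⟨_, h⟩ => h, fun h => ⟨hx h.1, h⟩⟩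

/-- The interval below `a` in `y` and the one below `a'` in `z` are Boolean algebras onto orthogonal
intervals, so their sum embeds. -/
theorem exists_glue (hy : a ∈ y.carrier) (hz : a ∈ z.carrier) :
    ∃ u : BSub A, ∀ c, c ∈ u.carrier ↔ ∃ p ∈ y.carrier, ∃ q ∈ z.carrier,
      OrthoLE p a ∧ OrthoLE q (oc a) ∧ OSum p q c := by
  have h1 := y.isBoolEmb.isBoolEmb_iic ⟨a, hy⟩
  have h2 := z.isBoolEmb.isBoolEmb_iic ⟨oc a, z.oc_mem _ hz⟩
  refine ⟨(IsBoolEmb.isBoolEmb_sum h1 h2 (sum_oc a)).range, fun c => ?_⟩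
  rw [IsBoolEmb.mem_range_sum h1 h2 (sum_oc a)]
  constructor
  · rintro ⟨p, q, h⟩
    exact ⟨_, p.1.2, _, q.1.2, BSub.le_iff.1 p.2, BSub.le_iff.1 q.2, h⟩
  · rintro ⟨p, hp, q, hq, hpa, hqa, h⟩
    exact ⟨⟨⟨p, hp⟩, BSub.le_iff.2 hpa⟩, ⟨⟨q, hq⟩, BSub.le_iff.2 hqa⟩, h⟩

/-- Since `y` has nothing new below `a` and `z` nothing new below `a'`, gluing the part of `z` below
`a` to the part of `y` below `a'` yields a `u` containing both. -/
theorem exists_common_cover (hy : four a ⋖ y) (hz : four a ⋖ z) {hay : a ∈ y.carrier}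
    {haz : oc a ∈ z.carrier} (h1 : idealSub y a hay = four a)
    (h2 : idealSub z (oc a) haz = four a) : ∃ u, IsLUB {y, z} u ∧ y ⋖ u ∧ z ⋖ u := by
  obtain ⟨u, hu⟩ := exists_glue (BSub.oc_mem_iff.1 haz) hay
  have below_y : ∀ p ∈ y.carrier, OrthoLE p a → p ∈ (four a).carrier := fun p hp hpa =>
    h1 ▸ mem_idealSub.2 ⟨hp, Or.inl hpa⟩
  have below_z : ∀ p ∈ z.carrier, OrthoLE p (oc a) → p ∈ (four a).carrier := fun p hp hpa =>
    h2 ▸ mem_idealSub.2 ⟨hp, Or.inl hpa⟩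
  have hyu : y ≤ u := by
    intro c hc
    obtain ⟨p, hp, q, hq, hpa, hqa, hsum⟩ := exists_split hay hc
    exact (hu c).2 ⟨p, hz.le (below_y p hp hpa), q, hq, hpa, hqa, hsum⟩
  have hzu : z ≤ u := by
    intro c hc
    obtain ⟨p, hp, q, hq, hpa, hqa, hsum⟩ := exists_split (BSub.oc_mem_iff.1 haz) hc
    exact (hu c).2 ⟨p, hp, q, hy.le (below_z q hq hqa), hpa, hqa, hsum⟩
  have least : ∀ v, y ≤ v → z ≤ v → u ≤ v := by
    intro v hyv hzv c hc
    obtain ⟨p, hp, q, hq, -, -, hsum⟩ := (hu c).1 hc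
    exact v.sum_mem _ _ _ (hzv hp) (hyv hq) hsum
  have not_le₁ : ¬ z ≤ y := by
    intro hzy
    refine hz.lt.not_ge fun c hc => ?_
    obtain ⟨p, hp, q, hq, hpa, hqa, hsum⟩ := exists_split (BSub.oc_mem_iff.1 haz) hc
    exact OrthoSubalgebra.sum_mem _ _ _ _ (below_y p (hzy hp) hpa) (below_z q hq hqa) hsum
  have not_le₂ : ¬ y ≤ z := by
    intro hyz
    refine hy.lt.not_ge fun c hc => ?_
    obtain ⟨p, hp, q, hq, hpa, hqa, hsum⟩ := exists_split hay hc
    exact OrthoSubalgebra.sum_mem _ _ _ _ (below_y p hp hpa) (below_z q (hyz hq) hqa) hsum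
  -- For a cover `w` of `four a`, one element of `w` outside `four a` suffices: the intersection
  -- with `v` then cannot be `four a`, so it is `w`.
  have absorb : ∀ v w p, four a ⋖ w → w ≤ u → v ≤ u → four a ≤ v → p ∈ v.carrier →
      p ∈ w.carrier → p ∉ (four a).carrier → w ≤ v := by
    intro v w p hw hwu hvu hav hpv hpw hpn
    obtain ⟨t, ht⟩ := exists_inter hwu hvu
    have hat : four a ≤ t := fun b hb => (ht b).2 ⟨hw.le hb, hav hb⟩
    have htw : t ≤ w := fun b hb => ((ht b).1 hb).1
    rcases hw.eq_or_eq hat htw with e | e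
    · exact absurd (e ▸ (ht p).2 ⟨hpw, hpv⟩) hpn
    · exact fun b hb => ((ht b).1 (e ▸ hb)).2
  refine ⟨u, ⟨?_, fun v hv => least v (hv (by simp)) (hv (by simp))⟩, ⟨?_, ?_⟩, ?_, ?_⟩
  · rintro _ (rfl | rfl)
    · exact hyu
    · exact hzu
  · exact lt_of_le_not_ge hyu fun h => not_le₁ (hzu.trans h)
  · intro v hyv hvu
    obtain ⟨c, hc, hcy⟩ := Set.not_subset.1 hyv.not_ge
    obtain ⟨p, hp, q, hq, -, -, hsum⟩ := (hu c).1 (hvu.le hc)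
    have hpv : p ∈ v.carrier := BSub.mem_of_sum (hyv.le hq) hc (comm hsum)
    have hpn : p ∉ (four a).carrier := fun h => hcy (y.sum_mem _ _ _ (hy.le h) hq hsum)
    exact hvu.not_ge (least v hyv.le
      (absorb v z p hz hzu hvu.le (hy.le.trans hyv.le) hpv hp hpn))
  · exact lt_of_le_not_ge hzu fun h => not_le₂ (hyu.trans h)
  · intro v hzv hvu
    obtain ⟨c, hc, hcz⟩ := Set.not_subset.1 hzv.not_ge
    obtain ⟨p, hp, q, hq, -, -, hsum⟩ := (hu c).1 (hvu.le hc)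
    have hqv : q ∈ v.carrier := BSub.mem_of_sum (hzv.le hp) hc hsum
    have hqn : q ∉ (four a).carrier := fun h => hcz (z.sum_mem _ _ _ hp (hz.le h) hsum)
    exact hvu.not_ge (least v
      (absorb v y q hy hyu hvu.le (hz.le.trans hzv.le) hqv hq hqn) hzv.le)

end IdealSub

/-! ### Directions of `BSub A` and the isomorphism. -/

section Direction

variable {A : Type u} [OrthoOps A] [IsOrthoalgebra A] {a b c : A} {x y z u : BSub A}

/-- The direction of `BSub A` corresponding to an element `a`. -/
noncomputable def directionOf (a : A) : ODir (BSub A) where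
  base := four a
  basic := isBasic_four a
  val y := (idealSub y.1 a (four_le_iff.1 y.2),
    idealSub y.1 (oc a) (y.1.oc_mem _ (four_le_iff.1 y.2)))
  principal y := ⟨idealSub_le, idealSub_le,
    (isPrincipalPairFor_four_iff (four_le_iff.1 y.2) y.2).2 (Or.inl ⟨rfl, rfl⟩)⟩
  restrict _ _ h := ⟨isGLB_idealSub h _, isGLB_idealSub h _⟩
  cover _ _ hy hz h₁ h₂ :=
    exists_common_cover hy hz (congrArg Prod.fst h₁) (congrArg Prod.snd h₂)

theorem isDirectionOf_directionOf (a : A) : IsDirectionOf a (directionOf a) := by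
  refine ⟨Set.ext fun b => mem_four, fun y => ⟨Set.ext fun b => ?_, Set.ext fun b => ?_⟩⟩
  · change b ∈ (idealSub y.1 a _).carrier ↔ _
    rw [mem_idealSub, and_or_left]
    rfl
  · change b ∈ (idealSub y.1 (oc a) _).carrier ↔ _
    rw [mem_idealSub, and_or_left, oc_oc]
    rfl

/-- The domain of `val` depends on the base, so values are compared with separate membership proofs
in place of a heterogeneous equality. -/
theorem oDir_ext {X : Type*} [PartialOrder X] [OrderBot X] {d e : ODir X} (hb : d.base = e.base)
    (hv : ∀ y h h', d.val ⟨y, h⟩ = e.val ⟨y, h'⟩) : d = e := by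
  obtain ⟨b, _, v, _, _, _⟩ := d
  obtain ⟨b', _, v', _, _, _⟩ := e
  obtain rfl : b = b' := hb
  obtain rfl : v = v' := funext fun y => hv y.1 y.2 y.2
  rfl

theorem directionOf_oc (a : A) : directionOf (oc a) = (directionOf a).compl :=
  oDir_ext (four_oc a) fun _ _ _ => Prod.ext rfl (idealSub_oc_oc _)

theorem directionOf_zero : directionOf (0 : A) = ODir.zero (BSub A) := by
  refine oDir_ext (four_eq_bot_iff.2 (Or.inl rfl)) fun y h h' => Prod.ext ?_ ?_
  · refine le_bot_iff.1 fun b hb => ?_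
    rcases (mem_idealSub.1 hb).2 with h | h
    · exact Or.inl (le_zero h)
    · rw [ortho_oc_zero] at h
      exact Or.inr (one_le h)
  · refine le_antisymm idealSub_le fun b hb => mem_idealSub.2 ⟨hb, Or.inl ?_⟩
    rw [ortho_oc_zero]
    exact ole_one b

theorem directionOf_one : directionOf (1 : A) = ODir.one (BSub A) := by
  rw [← ortho_oc_zero, directionOf_oc, directionOf_zero]
  rfl

theorem encard_four_le (a : A) : (four a).carrier.encard ≤ 4 := by
  have h : (four a).carrier = {0, a, oc a, 1} := Set.ext fun b => mem_four
  rw [h]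
  refine (Set.encard_insert_le _ _).trans ?_
  have h1 : ({a, oc a, 1} : Set A).encard ≤ 3 := by
    refine (Set.encard_insert_le _ _).trans ?_
    have h2 : ({oc a, 1} : Set A).encard ≤ 2 := by
      refine (Set.encard_insert_le _ _).trans ?_
      rw [Set.encard_singleton]
      norm_num
    calc _ ≤ (2 : ℕ∞) + 1 := add_le_add_left h2 1
      _ = 3 := by norm_num
  calc _ ≤ (3 : ℕ∞) + 1 := add_le_add_left h1 1
    _ = 4 := by norm_num

/-- Properness enters the proof only through this. -/
theorem not_isMax_four (hA : IsProperOrtho A) (a : A) : ¬ IsMax (four a) :=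
  fun h => (hA _ h).not_ge (encard_four_le a)

theorem hasEnoughDirections (hA : IsProperOrtho A) : HasEnoughDirections (BSub A) where
  orthodomain := isOrthodomain A
  proper x hx hb := by
    obtain ⟨a, rfl⟩ := isBasic_iff.1 hb
    exact not_isMax_four hA a hx
  exists_direction x hb := by
    obtain ⟨a, rfl⟩ := isBasic_iff.1 hb
    exact ⟨directionOf a, rfl⟩

/-- Equal bases leave only `a = b'`, and this is refuted by evaluating at any `y` strictly above the
base. -/
theorem directionOf_injective (hA : IsProperOrtho A) :
    Function.Injective (directionOf : A → ODir (BSub A)) := by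
  intro a b h
  rcases four_eq_four_iff.1 (congrArg ODir.base h) with h' | h'
  · exact h'
  · subst h'
    obtain ⟨y, hy⟩ := not_isMax_iff.1 (not_isMax_four hA b)
    have hv : ∀ d e : ODir (BSub A), d = e → ∀ y h h', d.val ⟨y, h⟩ = e.val ⟨y, h'⟩ := by
      rintro d _ rfl y h h'
      rfl
    have := congrArg Prod.fst (hv _ _ h y ((four_oc b).trans_le hy.le) hy.le)
    exact absurd this.symm (idealSub_ne hy _ _)

theorem directionOf_surjective (hA : IsProperOrtho A) :
    Function.Surjective (directionOf : A → ODir (BSub A)) := by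
  intro d
  suffices H : ∃ a, d.base = four a ∧ ∀ y h h', d.val ⟨y, h⟩ = (directionOf a).val ⟨y, h'⟩ by
    obtain ⟨a, h, h'⟩ := H
    exact ⟨a, (oDir_ext h h').symm⟩
  obtain ⟨x, basic, val, principal, restrict, cover⟩ := d
  obtain ⟨a, rfl⟩ := isBasic_iff.1 basic
  dsimp only
  have hm : ∀ y : Set.Ici (four a), a ∈ y.1.carrier := fun y => four_le_iff.1 y.2
  have hm' : ∀ y : Set.Ici (four a), oc a ∈ y.1.carrier := fun y => y.1.oc_mem _ (hm y)
  -- `P` and `Q` say that the direction chooses `a`, respectively `a'`, at `y`.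
  let P : Set.Ici (four a) → Prop := fun y =>
    (val y).1 = idealSub y.1 a (hm y) ∧ (val y).2 = idealSub y.1 (oc a) (hm' y)
  let Q : Set.Ici (four a) → Prop := fun y =>
    (val y).1 = idealSub y.1 (oc a) (hm' y) ∧ (val y).2 = idealSub y.1 a (hm y)
  have hPQ : ∀ y, P y ∨ Q y := by
    intro y
    obtain ⟨h₁, h₂, h⟩ := principal y
    exact (isPrincipalPairFor_four_iff (hm y) y.2).1 h
  have hP : ∀ y z, y ≤ z → P z → P y := by
    intro y z hyz h
    obtain ⟨h₁, h₂⟩ := restrict y z hyz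
    rw [h.1] at h₁
    rw [h.2] at h₂
    exact ⟨h₁.unique (isGLB_idealSub hyz _), h₂.unique (isGLB_idealSub hyz _)⟩
  have hQ : ∀ y z, y ≤ z → Q z → Q y := by
    intro y z hyz h
    obtain ⟨h₁, h₂⟩ := restrict y z hyz
    rw [h.1] at h₁
    rw [h.2] at h₂
    exact ⟨h₁.unique (isGLB_idealSub hyz _), h₂.unique (isGLB_idealSub hyz _)⟩
  have hne : ∀ y, four a < y.1 → P y → ¬ Q y := fun y hy h h' =>
    idealSub_ne hy (hm y) (hm' y) (h.1.symm.trans h'.1)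
  have consistent : ∀ y z, four a ⋖ y.1 → four a ⋖ z.1 → P y → ¬ Q z := by
    intro y z hy hz hPy hQz
    -- If both covers grow on the same side of `a`, opposite choices read `(x, y)` and `(z, x)` up
    -- to exchanging `y` and `z`, and condition (3) applies. If they grow on different sides, gluing
    -- provides the bound without it.
    obtain ⟨u, hyu, hzu⟩ : ∃ u, y.1 ≤ u ∧ z.1 ≤ u := by
      have of_lub : ∀ y z : BSub A, (∃ u, IsLUB {y, z} u ∧ y ⋖ u ∧ z ⋖ u) →
          ∃ u, y ≤ u ∧ z ≤ u := fun y z ⟨u, _, h₁, h₂⟩ => ⟨u, h₁.le, h₂.le⟩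
      have swap : ∀ y z : BSub A, (∃ u, y ≤ u ∧ z ≤ u) → ∃ u, z ≤ u ∧ y ≤ u :=
        fun y z ⟨u, h₁, h₂⟩ => ⟨u, h₂, h₁⟩
      rcases idealSub_of_covBy hy (hm y) (hm' y) with ⟨hy₁, hy₂⟩ | ⟨hy₁, hy₂⟩ <;>
        rcases idealSub_of_covBy hz (hm z) (hm' z) with ⟨hz₁, hz₂⟩ | ⟨hz₁, hz₂⟩
      · exact of_lub _ _ (cover y z hy hz (Prod.ext (hPy.1.trans hy₁) (hPy.2.trans hy₂))
          (Prod.ext (hQz.1.trans hz₂) (hQz.2.trans hz₁)))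
      · exact of_lub _ _ (exists_common_cover hy hz hy₁ hz₂)
      · exact swap _ _ (of_lub _ _ (exists_common_cover hz hy hz₁ hy₂))
      · exact swap _ _ (of_lub _ _ (cover z y hz hy (Prod.ext (hQz.1.trans hz₂) (hQz.2.trans hz₁))
          (Prod.ext (hPy.1.trans hy₁) (hPy.2.trans hy₂))))
    rcases hPQ ⟨u, hy.le.trans hyu⟩ with h | h
    · exact hne z hz.lt (hP z _ hzu h) hQz
    · exact hne y hy.lt hPy (hQ y _ hyu h)
  -- At the base itself the two choices agree, so nothing has to be decided there.
  have eq_four : ∀ y : Set.Ici (four a), ¬ four a < y.1 → idealSub y.1 a (hm y) = four a ∧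
      idealSub y.1 (oc a) (hm' y) = four a := by
    intro y hy
    have e : y.1 ≤ four a := by
      rcases (show four a ≤ y.1 from y.2).eq_or_lt with h | h
      · exact h.ge
      · exact absurd h hy
    exact ⟨le_antisymm (idealSub_le.trans e) four_le_idealSub,
      le_antisymm (idealSub_le.trans e) four_le_idealSub_oc⟩
  obtain ⟨y₀, hy₀⟩ := not_isMax_iff.1 (not_isMax_four hA a)
  -- The choice at this one cover decides between `a` and `a'` everywhere.
  obtain ⟨y₁, hy₁, -⟩ := exists_cover_le hy₀
  rcases hPQ ⟨y₁, hy₁.le⟩ with h₁ | h₁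
  · refine ⟨a, rfl, fun y h h' => ?_⟩
    have hy : P ⟨y, h⟩ := by
      rcases hPQ ⟨y, h⟩ with hy | hy
      · exact hy
      by_cases hlt : four a < y
      · obtain ⟨w, hw, hwy⟩ := exists_cover_le hlt
        exact absurd (hQ ⟨w, hw.le⟩ ⟨y, h⟩ hwy hy) (consistent _ _ hy₁ hw h₁)
      · obtain ⟨e₁, e₂⟩ := eq_four ⟨y, h⟩ hlt
        exact ⟨hy.1.trans (e₂.trans e₁.symm), hy.2.trans (e₁.trans e₂.symm)⟩
    exact Prod.ext hy.1 hy.2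
  · refine ⟨oc a, (four_oc a).symm, fun y h h' => ?_⟩
    have hy : Q ⟨y, h⟩ := by
      rcases hPQ ⟨y, h⟩ with hy | hy
      · by_cases hlt : four a < y
        · obtain ⟨w, hw, hwy⟩ := exists_cover_le hlt
          exact absurd h₁ (consistent ⟨w, hw.le⟩ _ hw hy₁ (hP ⟨w, hw.le⟩ ⟨y, h⟩ hwy hy))
        · obtain ⟨e₁, e₂⟩ := eq_four ⟨y, h⟩ hlt
          exact ⟨hy.1.trans (e₁.trans e₂.symm), hy.2.trans (e₂.trans e₁.symm)⟩
      · exact hy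
    exact Prod.ext hy.1 (hy.2.trans (idealSub_oc_oc _).symm)

/-- The value at `w` of `d_a` gives `b ≤ a'` or `a ≤ b`, and that of `d_b` gives `a ≤ b'` or `b ≤
a`; as `a ≠ b`, the two are orthogonal. Then `w` is the eight-element subalgebra they span, and `c`
is their sum `s` or `s'`. -/
theorem sum_of_near {w : BSub A} (ha : four a ≤ w) (hb : four b ≤ w) (hc : four c ≤ w)
    (hn : IsNearWith (four a) (four b) w) (hda : (directionOf a).val ⟨w, ha⟩ = (four a, w))
    (hdb : (directionOf b).val ⟨w, hb⟩ = (four b, w)) (hat : IsAtom (four c))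
    (hca : four c ≠ four a) (hcb : four c ≠ four b)
    (hdc : (directionOf c).val ⟨w, hc⟩ = (w, four c)) : OSum a b c := by
  obtain ⟨hxa, hxb, hab, -, hcov, -⟩ := hn
  have ha0 : a ≠ 0 := fun h => hxa.1 (four_eq_bot_iff.2 (Or.inl h))
  have hb0 : b ≠ 0 := fun h => hxb.1 (four_eq_bot_iff.2 (Or.inl h))
  have hc0 : c ≠ 0 := fun h => hat.1 (four_eq_bot_iff.2 (Or.inl h))
  have hc1 : c ≠ 1 := fun h => hat.1 (four_eq_bot_iff.2 (Or.inr h))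
  have hmb : b ∈ (idealSub w (oc a) (w.oc_mem _ (four_le_iff.1 ha))).carrier := by
    rw [show idealSub w (oc a) _ = w from congrArg Prod.snd hda]
    exact four_le_iff.1 hb
  have hma : a ∈ (idealSub w (oc b) (w.oc_mem _ (four_le_iff.1 hb))).carrier := by
    rw [show idealSub w (oc b) _ = w from congrArg Prod.snd hdb]
    exact four_le_iff.1 ha
  have hle : OrthoLE b (oc a) := by
    rcases (mem_idealSub.1 hmb).2 with h | h
    · exact h
    · rcases (mem_idealSub.1 hma).2 with h' | h'
      · exact le_oc_iff.1 h'
      · rw [oc_oc] at h h'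
        exact absurd (congrArg four (ole_antisymm h h')) hab
  obtain ⟨s, hs⟩ := orth_iff.2 hle
  have hs1 : s ≠ 1 := by
    rintro rfl
    rw [(sum_eq_one_iff _ _).1 hs, four_oc] at hab
    exact hab rfl
  obtain rfl := eight_eq_of_covBy (h := hs) (he := ha0) (hf := hb0) (hs := hs1) hcov
    (eight_le_iff.2 ⟨four_le_iff.1 ha, four_le_iff.1 hb⟩)
  have key : ∀ d, c ∈ (four d).carrier → c = d ∨ c = oc d := by
    intro d hd
    rcases mem_four.1 hd with h | h | h | h
    · exact absurd h hc0
    · exact Or.inl h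
    · exact Or.inr h
    · exact absurd h hc1
  rcases mem_eight (four_le_iff.1 hc) with h | h | h
  · exact absurd (four_eq_four_iff.2 (key _ h)) hca
  · exact absurd (four_eq_four_iff.2 (key _ h)) hcb
  · rcases key _ h with rfl | rfl
    · exact hs
    -- If `c = s'`, the value of `d_c` would confine the elements of `w` below `s` to `four s`; but
    -- `a ≤ s` is not in it.
    · have hm : a ∈ (idealSub (eight hs ha0 hb0 hs1) (oc (oc s))
          (OrthoSubalgebra.oc_mem _ _ (four_le_iff.1 hc))).carrier :=
        mem_idealSub.2 ⟨left_mem_eight, Or.inl (by rw [oc_oc]; exact le_sum_left hs)⟩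
      rw [show idealSub _ (oc (oc s)) _ = four (oc s) from congrArg Prod.snd hdc, four_oc] at hm
      rcases mem_four.1 hm with h | h | h | h
      · exact absurd h ha0
      · subst h
        exact absurd (cancel hs (ortho_sum_zero _)) hb0
      · exact absurd (eq_zero_of_le_oc (le_sum_left hs) (h ▸ ole_refl _)) ha0
      · subst h
        exact absurd (four_eq_bot_iff.2 (Or.inr rfl)) hxa.1

/-- At a cover there are only two possible values, and one new element below `a'` tells which
occurs. -/
theorem val_eq_of_covBy {w : BSub A} (ha : four a ⋖ w) (hb : b ∈ w.carrier)
    (hba : OrthoLE b (oc a)) (hn : b ∉ (four a).carrier) :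
    (directionOf a).val ⟨w, ha.le⟩ = (four a, w) := by
  have hm := four_le_iff.1 ha.le
  rcases idealSub_of_covBy ha hm (w.oc_mem _ hm) with ⟨h₁, h₂⟩ | ⟨h₁, h₂⟩
  · exact Prod.ext h₁ h₂
  · refine absurd ?_ hn
    rw [← h₂]
    exact mem_idealSub.2 ⟨hb, Or.inl hba⟩

theorem sum_directionOf_iff (hA : IsProperOrtho A) :
    OSum (directionOf a) (directionOf b) (directionOf c) ↔ OSum a b c := by
  have inj := directionOf_injective hA
  change (directionOf b = ODir.zero _ ∧ directionOf c = directionOf a) ∨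
    (directionOf a = ODir.zero _ ∧ directionOf c = directionOf b) ∨
    (directionOf b = (directionOf a).compl ∧ directionOf c = ODir.one _) ∨ _ ↔ _
  rw [← directionOf_zero, ← directionOf_one, ← directionOf_oc, inj.eq_iff, inj.eq_iff, inj.eq_iff,
    inj.eq_iff, inj.eq_iff, inj.eq_iff]
  constructor
  · rintro (⟨rfl, rfl⟩ | ⟨rfl, rfl⟩ | ⟨rfl, rfl⟩ | ⟨w, ha, hb, hc, hn, hda, hdb, hat, hca, hcb, hdc⟩)
    · exact ortho_sum_zero _
    · exact zero_sum _
    · exact sum_oc _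
    · exact sum_of_near ha hb hc hn hda hdb hat hca hcb hdc
  · intro h
    by_cases hb0 : b = 0
    · subst hb0
      exact Or.inl ⟨rfl, sum_zero_iff.1 h⟩
    by_cases ha0 : a = 0
    · subst ha0
      exact Or.inr (Or.inl ⟨rfl, uniq h (zero_sum b)⟩)
    by_cases hc1 : c = 1
    · subst hc1
      exact Or.inr (Or.inr (Or.inl ⟨(sum_eq_one_iff _ _).1 h, rfl⟩))
    refine Or.inr (Or.inr (Or.inr ?_))
    have hba : b ∉ (four a).carrier := notMem_four_of_sum h ha0 hb0 hc1
    have hab : a ∉ (four b).carrier := notMem_four_of_sum (comm h) hb0 ha0 hc1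
    have ha1 : a ≠ 1 := fun e => hab (e ▸ OrthoSubalgebra.one_mem _)
    have hb1 : b ≠ 1 := fun e => hba (e ▸ OrthoSubalgebra.one_mem _)
    have hc0 : c ≠ 0 := fun e => ha0 (le_zero (e ▸ le_sum_left h))
    have cov_a : four a ⋖ eight h ha0 hb0 hc1 := four_covBy_eight
    have cov_b : four b ⋖ eight h ha0 hb0 hc1 := by
      rw [eight_comm]
      exact four_covBy_eight
    have hoc0 : oc c ≠ 0 := mt oc_eq_zero.1 hc1
    have hoa1 : oc a ≠ 1 := mt oc_eq_one.1 ha0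
    have hob1 : oc b ≠ 1 := mt oc_eq_one.1 hb0
    have cov_c : four (oc c) ⋖ eight h ha0 hb0 hc1 := by
      rw [eight_rotate, eight_comm]
      exact four_covBy_eight
    have hac : a ∉ (four (oc c)).carrier :=
      notMem_four_of_sum (comm (rotate (comm h))) hoc0 ha0 hob1
    have hbc : b ∉ (four (oc c)).carrier :=
      notMem_four_of_sum (comm (rotate h)) hoc0 hb0 hoa1
    -- The third atom is `c'`, with `a` as a new element below `c`; exchanging the components then
    -- gives the value for `c`.
    have hdc := val_eq_of_covBy cov_c left_mem_eight
      (by rw [oc_oc]; exact le_sum_left h) hac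
    refine ⟨eight h ha0 hb0 hc1, cov_a.le, cov_b.le, four_le_iff.2 sum_mem_eight,
      ⟨isAtom_four ha0 ha1, isAtom_four hb0 hb1, fun e => hba (four_le_iff.1 (le_of_eq (Eq.symm e))), isLUB_eight,
        cov_a, cov_b⟩,
      val_eq_of_covBy cov_a right_mem_eight (orth_iff.1 ⟨_, h⟩) hba,
      val_eq_of_covBy cov_b left_mem_eight (orth_iff.1 ⟨_, comm h⟩) hab,
      isAtom_four hc0 hc1, fun e => hac ?_, fun e => hbc ?_, ?_⟩
    · rw [four_oc]
      exact four_le_iff.1 (le_of_eq (Eq.symm e))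
    · rw [four_oc]
      exact four_le_iff.1 (le_of_eq (Eq.symm e))
    · have e₁ := congrArg Prod.fst hdc
      have e₂ := congrArg Prod.snd hdc
      refine Prod.ext ?_ ?_
      · exact (idealSub_oc_oc _).symm.trans e₂
      · exact e₁.trans (four_oc c)

/-- Each axiom transfers along the bijection, because sums are reflected as well as preserved. -/
theorem isOrthoalgebra_oDir (hA : IsProperOrtho A) : IsOrthoalgebra (ODir (BSub A)) := by
  have surj := directionOf_surjective hA
  have inj := directionOf_injective hA
  have h0 : (0 : ODir (BSub A)) = directionOf 0 := directionOf_zero.symm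
  have h1 : (1 : ODir (BSub A)) = directionOf 1 := directionOf_one.symm
  have hoc : ∀ a : A, oc (directionOf a) = directionOf (oc a) := fun a => (directionOf_oc a).symm
  constructor
  · simp only [surj.forall, sum_directionOf_iff hA, inj.eq_iff]
    exact sum_unique
  · simp only [surj.forall, sum_directionOf_iff hA]
    exact sum_comm
  · simp only [surj.forall, surj.exists, sum_directionOf_iff hA]
    exact sum_assoc
  · simp only [surj.forall, h1, hoc, sum_directionOf_iff hA, inj.eq_iff]
    exact sum_eq_one_iff
  · simp only [surj.forall, surj.exists, h0, sum_directionOf_iff hA, inj.eq_iff]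
    exact sum_self_iff

theorem isOrthoIso_directionOf (hA : IsProperOrtho A) :
    IsOrthoIso (directionOf : A → ODir (BSub A)) := by
  obtain ⟨g, hl, hr⟩ := Function.bijective_iff_has_inverse.1
    ⟨directionOf_injective hA, directionOf_surjective hA⟩
  refine ⟨⟨directionOf_oc, fun a b c h => (sum_directionOf_iff hA).2 h⟩, g, ⟨fun d => ?_,
    fun d e f h => ?_⟩, hl, hr⟩
  · apply directionOf_injective hA
    rw [hr, directionOf_oc, hr]
    rfl
  · rw [← sum_directionOf_iff hA, hr, hr, hr]
    exact h

end Direction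

end Ortho

/-- For a proper orthoalgebra `A`, the poset `BSub A` is an orthodomain with enough directions, its
directions form an orthoalgebra, and `a ↦ d_a` is an orthoalgebra isomorphism. -/
theorem theorem1p1 {A : Type u} [OrthoOps A] [IsOrthoalgebra A] (hA : IsProperOrtho A) :
    HasEnoughDirections (BSub A) ∧
      IsOrthoalgebra (ODir (BSub A)) ∧
      ∃ ξ : A → ODir (BSub A), (∀ a : A, IsDirectionOf a (ξ a)) ∧ IsOrthoIso ξ :=
  ⟨Ortho.hasEnoughDirections hA, Ortho.isOrthoalgebra_oDir hA, Ortho.directionOf,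
    Ortho.isDirectionOf_directionOf, Ortho.isOrthoIso_directionOf hA⟩
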